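/- Let $X$ be a connected Hausdorff complex manifold (for instance, a connected smooth complex projective variety), let $D$ be a reduced effective divisor on $X$, and let $E$ be a holomorphic vector bundle of rank $n$ on $X$. Let $\Omega^1_X(\log D)$ be the sheaf of meromorphic $1$-forms $\alpha$, holomorphic outside $D$, such that $\alpha$ and $d\alpha$ have at most a simple pole along $D$, that is, $f\alpha$ and $f\,d\alpha$ are holomorphic for every local equation $f$ of $D$; let $TX(-\log D)=(\Omega^1_X(\log D))^\vee\subseteq TX$ be its dual. A logarithmic connection on $E$ singular along $D$ is a $\mathbb C$-linear sheaf homomorphism $\nabla:E\to E\otimes_{\mathcal O_X}\Omega^1_X(\log D)$ with $\nabla(fs)=f\nabla(s)+s\otimes df$ for all local sections $f$ of $\mathcal O_X$ and $s$ of $E$. Let $p:P\to X$ be the holomorphic frame bundle of $E$, a principal $\mathrm{GL}_n(\mathbb C)$-bundle, let $\mathrm{At}(P)=TP/\mathrm{GL}_n(\mathbb C)$, whose sections over $U$ are the $\mathrm{GL}_n(\mathbb C)$-invariant holomorphic vector fields on $p^{-1}(U)$, let $d'p:\mathrm{At}(P)\to TX$ be induced by the differential of $p$, and let $\mathcal A_D(P)=(d'p)^{-1}(TX(-\log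 D))$. Then $E$ admits a logarithmic connection singular along $D$ if and only if the logarithmic Atiyah exact sequence $$0\to\mathrm{ad}(P)\to\mathcal A_D(P)\xrightarrow{\ d'p\ }TX(-\log D)\to 0$$ splits holomorphically, that is, if and only if there is a homomorphism of sheaves of $\mathcal O_X$-modules $\eta:TX(-\log D)\to\mathcal A_D(P)$ with $d'p\circ\eta=\mathrm{id}$. -/

import Mathlib

open scoped Manifold ContDiff Topology Matrix
open Bundle TopologicalSpace

set_option linter.unusedSectionVars false

noncomputable section

namespace LogAtiyah

/-! ### Holomorphic sections over open sets

A section over an open set `U` is stored as a section on the whole base that is extended by zero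
outside `U`; only its values on `U` are constrained, and two sections over `U` are equal exactly
when they agree on `U`. Over `ℂ`, `ContMDiffOn _ _ ω` means holomorphic. -/

section Sections

variable {B : Type*} [NormedAddCommGroup B] [NormedSpace ℂ B] {H : Type*} [TopologicalSpace H]
  (J : ModelWithCorners ℂ B H) {M : Type*} [TopologicalSpace M] [ChartedSpace H M]
  (F : Type*) [NormedAddCommGroup F] [NormedSpace ℂ F]
  (E : M → Type*) [TopologicalSpace (TotalSpace F E)]
  [∀ x, AddCommGroup (E x)] [∀ x, Module ℂ (E x)] [∀ x, TopologicalSpace (E x)]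
  [FiberBundle F E] [VectorBundle ℂ F E]

/-- `Γ(U, E)`: holomorphic sections over `U` of the vector bundle `E`. -/
def Sec (U : Opens M) : Submodule ℂ (Π x, E x) where
  carrier := {s | ContMDiffOn J (J.prod 𝓘(ℂ, F)) ω (fun x => TotalSpace.mk' F x (s x)) U ∧
    ∀ x ∉ U, s x = 0}
  add_mem' := fun ha hb =>
    ⟨ha.1.add_section hb.1, fun x hx => by simp [ha.2 x hx, hb.2 x hx]⟩
  zero_mem' := ⟨(contMDiff_zeroSection ℂ E).contMDiffOn, fun _ _ => rfl⟩
  smul_mem' := fun _ _ hs =>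
    ⟨hs.1.const_smul_section, fun x hx => by simp [hs.2 x hx]⟩

variable {J F E}

theorem Sec.smul_mem {U : Opens M} {f : M → ℂ} (hf : ContMDiffOn J 𝓘(ℂ) ω f U)
    {s : Π x, E x} (hs : s ∈ Sec J F E U) : (fun x => f x • s x) ∈ Sec J F E U :=
  ⟨hf.smul_section hs.1, fun x hx => by simp [hs.2 x hx]⟩

open Classical in
/-- Restriction of a section to a smaller open set. -/
def restrictTo (W : Opens M) (s : Π x, E x) : Π x, E x := fun x => if x ∈ W then s x else 0

theorem Sec.restrict_mem {U W : Opens M} (h : W ≤ U) {s : Π x, E x} (hs : s ∈ Sec J F E U) :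
    restrictTo W s ∈ Sec J F E W := by
  refine ⟨(hs.1.mono h).congr fun x hx => ?_, fun x hx => if_neg hx⟩
  have hx' : x ∈ W := hx
  simp [restrictTo, hx']

end Sections

section Base

variable {V : Type*} [NormedAddCommGroup V] [NormedSpace ℂ V]
  {X : Type*} [TopologicalSpace X] [ChartedSpace V X]

/-! ### Reduced effective divisors -/

/-- `f` is a local equation on the open set `W` of the reduced hypersurface with support `S`: it is
holomorphic on `W`, vanishes exactly on `S ∩ W`, and generates over `W` the ideal sheaf of
holomorphic functions vanishing on `S`. -/
structure IsLocalEquation (S : Set X) (W : Opens X) (f : X → ℂ) : Prop where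
  holo : ContMDiffOn 𝓘(ℂ, V) 𝓘(ℂ) ω f W
  zero_iff : ∀ x ∈ W, f x = 0 ↔ x ∈ S
  generates : ∀ W' ≤ W, ∀ g : X → ℂ, ContMDiffOn 𝓘(ℂ, V) 𝓘(ℂ) ω g W' →
    (∀ x ∈ W', x ∈ S → g x = 0) →
      ∃ h : X → ℂ, ContMDiffOn 𝓘(ℂ, V) 𝓘(ℂ) ω h W' ∧ ∀ x ∈ W', g x = h x * f x

variable (V X) in
/-- A reduced effective divisor on a complex manifold, given by its support: a closed nowhere dense
subset whose (automatically radical) ideal sheaf is locally principal. -/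
structure ReducedDivisor where
  supp : Set X
  isClosed : IsClosed supp
  nowhereDense : interior supp = ∅
  exists_localEquation : ∀ x : X, ∃ W : Opens X, x ∈ W ∧
    ∃ f : X → ℂ, IsLocalEquation (V := V) supp W f

/-- The open set `U \ D`. -/
def ReducedDivisor.away (D : ReducedDivisor V X) (U : Opens X) : Opens X :=
  U ⊓ ⟨D.suppᶜ, D.isClosed.isOpen_compl⟩

/-! ### Logarithmic forms -/

/-- Forms of degree one with values in `E`, as families of linear maps `T_x X → E_x`. -/
abbrev FormField (E : X → Type*) [∀ x, AddCommGroup (E x)] [∀ x, Module ℂ (E x)]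
    [∀ x, TopologicalSpace (E x)] : Type _ :=
  Π x : X, TangentSpace 𝓘(ℂ, V) x →L[ℂ] E x

/-- The expression of a scalar `1`-form in the preferred coordinates at `x₀`, that is, its pullback
by the inverse of the chart at `x₀`. -/
def coordForm (α : FormField (V := V) (Trivial X ℂ)) (x₀ : X) (y : V) : V →L[ℂ] ℂ :=
  (α ((extChartAt 𝓘(ℂ, V) x₀).symm y)).comp
    (mfderiv 𝓘(ℂ, V) 𝓘(ℂ, V) (extChartAt 𝓘(ℂ, V) x₀).symm y)

/-- The exterior derivative of a scalar `1`-form, computed in the coordinates at `x₀`. -/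
def coordExtDeriv (α : FormField (V := V) (Trivial X ℂ)) (x₀ : X) (y : V) :
    V [⋀^Fin 2]→L[ℂ] ℂ :=
  extDeriv (fun z => ContinuousAlternatingMap.ofSubsingleton ℂ V ℂ (0 : Fin 1)
    (coordForm α x₀ z)) y

variable [IsManifold 𝓘(ℂ, V) ω X]

/-- Sections over `U` of `Ω¹_X(log D)`: the `1`-forms `α`, holomorphic on `U \ D`, such that `α` and
`dα` have at most a simple pole along `D`, that is, for every local equation `f` of `D` on an open
subset of `U` the forms `f α` and `f dα` extend holomorphically across `D`. -/
structure IsLogForm (D : ReducedDivisor V X) (U : Opens X)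
    (α : FormField (V := V) (Trivial X ℂ)) : Prop where
  holo : α ∈ Sec 𝓘(ℂ, V) (V →L[ℂ] ℂ)
    (fun x => TangentSpace 𝓘(ℂ, V) x →L[ℂ] Trivial X ℂ x) (D.away U)
  pole : ∀ W ≤ U, ∀ f : X → ℂ, IsLocalEquation (V := V) D.supp W f → ∀ x ∈ W,
    ∃ (a : V → V →L[ℂ] ℂ) (b : V → V [⋀^Fin 2]→L[ℂ] ℂ),
      AnalyticAt ℂ a (extChartAt 𝓘(ℂ, V) x x) ∧ AnalyticAt ℂ b (extChartAt 𝓘(ℂ, V) x x) ∧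
      ∀ᶠ z in 𝓝 x, z ∉ D.supp →
        f z • coordForm α x (extChartAt 𝓘(ℂ, V) x z) = a (extChartAt 𝓘(ℂ, V) x z) ∧
        f z • coordExtDeriv α x (extChartAt 𝓘(ℂ, V) x z) = b (extChartAt 𝓘(ℂ, V) x z)

/-- Sections over `U` of `TX(-log D)`, the dual of `Ω¹_X(log D)`, as a submodule of the holomorphic
vector fields on `U`: the fields `v` such that `α(v)` is a holomorphic function for every local
section `α` of `Ω¹_X(log D)`. -/
def TLog (D : ReducedDivisor V X) (U : Opens X) :
    Submodule ℂ (Π x : X, TangentSpace 𝓘(ℂ, V) x) where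
  carrier := {v | v ∈ Sec 𝓘(ℂ, V) V (TangentSpace 𝓘(ℂ, V) : X → Type _) U ∧
    ∀ W ≤ U, ∀ α : FormField (V := V) (Trivial X ℂ), IsLogForm D W α →
      ∃ h : X → ℂ, ContMDiffOn 𝓘(ℂ, V) 𝓘(ℂ) ω h W ∧
        ∀ x ∈ W, x ∉ D.supp → h x = α x (v x)}
  add_mem' := by
    rintro a b ⟨ha, ha'⟩ ⟨hb, hb'⟩
    refine ⟨add_mem ha hb, fun W hW α hα => ?_⟩
    obtain ⟨h, hh, hh'⟩ := ha' W hW α hα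
    obtain ⟨k, hk, hk'⟩ := hb' W hW α hα
    refine ⟨fun x => h x + k x, hh.add hk, fun x hx hxD => ?_⟩
    simp [hh' x hx hxD, hk' x hx hxD]
  zero_mem' := ⟨zero_mem _, fun W _ α _ => ⟨fun _ => 0, contMDiffOn_const, by simp⟩⟩
  smul_mem' := by
    rintro c a ⟨ha, ha'⟩
    refine ⟨Submodule.smul_mem _ c ha, fun W hW α hα => ?_⟩
    obtain ⟨h, hh, hh'⟩ := ha' W hW α hα
    refine ⟨fun x => c * h x, contMDiffOn_const.mul hh, fun x hx hxD => ?_⟩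
    simp [hh' x hx hxD]

theorem TLog.smul_mem {D : ReducedDivisor V X} {U : Opens X} {f : X → ℂ}
    (hf : ContMDiffOn 𝓘(ℂ, V) 𝓘(ℂ) ω f U) {v : Π x : X, TangentSpace 𝓘(ℂ, V) x}
    (hv : v ∈ TLog D U) : (fun x => f x • v x) ∈ TLog D U := by
  refine ⟨Sec.smul_mem hf hv.1, fun W hW α hα => ?_⟩
  obtain ⟨h, hh, hh'⟩ := hv.2 W hW α hα
  refine ⟨fun x => f x * h x, (hf.mono hW).mul hh, fun x hx hxD => ?_⟩
  simp [hh' x hx hxD]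

theorem TLog.restrict_mem {D : ReducedDivisor V X} {U W : Opens X} (hWU : W ≤ U)
    {v : Π x : X, TangentSpace 𝓘(ℂ, V) x} (hv : v ∈ TLog D U) :
    restrictTo W v ∈ TLog D W := by
  refine ⟨Sec.restrict_mem hWU hv.1, fun W' hW' α hα => ?_⟩
  obtain ⟨h, hh, hh'⟩ := hv.2 W' (hW'.trans hWU) α hα
  refine ⟨h, hh, fun x hx hxD => ?_⟩
  have hx' : x ∈ W := hW' hx
  simp [restrictTo, hx', hh' x hx hxD]

/-! ### Logarithmic connections on vector bundles -/

section Connection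

variable (F : Type*) [NormedAddCommGroup F] [NormedSpace ℂ F]
  (E : X → Type*) [TopologicalSpace (TotalSpace F E)]
  [∀ x, AddCommGroup (E x)] [∀ x, Module ℂ (E x)] [∀ x, TopologicalSpace (E x)]
  [∀ x, IsTopologicalAddGroup (E x)] [∀ x, ContinuousSMul ℂ (E x)]
  [FiberBundle F E] [VectorBundle ℂ F E]

/-- An `E`-valued form, holomorphic on `U \ D`, is a section over `U` of `E ⊗ Ω¹_X(log D)` if it is
locally on `U` a finite sum `∑ sᵢ ⊗ αᵢ` with `sᵢ` sections of `E` and `αᵢ` sections of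
`Ω¹_X(log D)`. -/
def IsTensorLogForm (D : ReducedDivisor V X) (U : Opens X) (β : FormField (V := V) E) : Prop :=
  ∀ x ∈ U, ∃ W ≤ U, x ∈ W ∧ ∃ (k : ℕ) (s : Fin k → Π y, E y)
    (α : Fin k → FormField (V := V) (Trivial X ℂ)),
    (∀ i, s i ∈ Sec 𝓘(ℂ, V) F E W) ∧ (∀ i, IsLogForm D W (α i)) ∧
    ∀ y ∈ W, y ∉ D.supp → ∀ v : TangentSpace 𝓘(ℂ, V) y, β y v = ∑ i, (α i y v : ℂ) • s i y

/-- A logarithmic connection `∇ : E → E ⊗ Ω¹_X(log D)` on `E` singular along `D`: a `ℂ`-linear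
homomorphism of sheaves satisfying the Leibniz rule. Sections of `E ⊗ Ω¹_X(log D)` are regarded as
`E`-valued forms on the complement of `D`. -/
structure LogConnection (D : ReducedDivisor V X) where
  nabla : ∀ U : Opens X, Sec 𝓘(ℂ, V) F E U →ₗ[ℂ]
    Sec 𝓘(ℂ, V) (V →L[ℂ] F) (fun x => TangentSpace 𝓘(ℂ, V) x →L[ℂ] E x) (D.away U)
  isLog : ∀ (U : Opens X) (s : Sec 𝓘(ℂ, V) F E U),
    IsTensorLogForm F E D U (nabla U s : FormField (V := V) E)
  restrict : ∀ (U W : Opens X) (hWU : W ≤ U) (s : Sec 𝓘(ℂ, V) F E U),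
    (nabla W ⟨restrictTo W s.1, Sec.restrict_mem hWU s.2⟩).1 =
      restrictTo (D.away W) (nabla U s).1
  leibniz : ∀ (U : Opens X) (f : X → ℂ) (hf : ContMDiffOn 𝓘(ℂ, V) 𝓘(ℂ) ω f U)
    (s : Sec 𝓘(ℂ, V) F E U), ∀ x ∈ D.away U,
    (nabla U ⟨fun y => f y • s.1 y, Sec.smul_mem hf s.2⟩).1 x =
      f x • (nabla U s).1 x + (mvfderiv 𝓘(ℂ, V) f x).smulRight (s.1 x)

end Connection

/-! ### The logarithmic Atiyah sequence of a principal bundle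

`p : P → X` is the projection of a holomorphic principal bundle, on whose total space the structure
group `G` acts from the right, that is, `Gᵐᵒᵖ` acts from the left. -/

section Atiyah

variable {B : Type*} [NormedAddCommGroup B] [NormedSpace ℂ B] {H : Type*} [TopologicalSpace H]
  (J : ModelWithCorners ℂ B H) {P : Type*} [TopologicalSpace P] [ChartedSpace H P]
  (p : C(P, X))

/-- The field `ξ` over `U` on `P` is mapped to the field `v` on `X` by the differential of `p`. -/
def ProjectsTo (U : Opens X) (ξ : Π q : P, TangentSpace J q)
    (v : Π x : X, TangentSpace 𝓘(ℂ, V) x) : Prop :=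
  ∀ q ∈ U.comap p, mfderiv J 𝓘(ℂ, V) p q (ξ q) = v (p q)

variable {J p} in
theorem ProjectsTo.add {U : Opens X} {ξ ζ : Π q : P, TangentSpace J q}
    {v w : Π x : X, TangentSpace 𝓘(ℂ, V) x}
    (h : ProjectsTo J p U ξ v) (h' : ProjectsTo J p U ζ w) :
    ProjectsTo J p U (ξ + ζ) (v + w) := fun q hq => by
  rw [Pi.add_apply, map_add, h q hq, h' q hq, Pi.add_apply]

variable {J p} in
theorem ProjectsTo.smul {U : Opens X} {ξ : Π q : P, TangentSpace J q}
    {v : Π x : X, TangentSpace 𝓘(ℂ, V) x} (c : ℂ) (h : ProjectsTo J p U ξ v) :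
    ProjectsTo J p U (c • ξ) (c • v) := fun q hq => by
  rw [Pi.smul_apply, map_smul, h q hq, Pi.smul_apply]

variable {J p} in
theorem ProjectsTo.unique (hp : Function.Surjective p) {D : ReducedDivisor V X} {U : Opens X}
    {ξ : Π q : P, TangentSpace J q} {v w : Π x : X, TangentSpace 𝓘(ℂ, V) x}
    (hv : v ∈ TLog D U) (hw : w ∈ TLog D U)
    (h : ProjectsTo J p U ξ v) (h' : ProjectsTo J p U ξ w) : v = w := by
  funext x
  by_cases hx : x ∈ U
  · obtain ⟨q, rfl⟩ := hp x
    exact (h q hx).symm.trans (h' q hx)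
  · rw [hv.1.2 x hx, hw.1.2 x hx]

variable [IsManifold J ω P] (G : Type*) [Group G] [MulAction Gᵐᵒᵖ P]

/-- Sections over `U` of the Atiyah bundle `TP / G`: the `G`-invariant holomorphic vector fields on
`p⁻¹(U)`. -/
def At (U : Opens X) : Submodule ℂ (Π q : P, TangentSpace J q) where
  carrier := {ξ | ξ ∈ Sec J B (TangentSpace J : P → Type _) (U.comap p) ∧
    ∀ (g : G), ∀ q ∈ U.comap p,
      mfderiv J J (fun q' : P => MulOpposite.op g • q') q (ξ q) = ξ (MulOpposite.op g • q)}
  add_mem' := fun ha hb => ⟨add_mem ha.1 hb.1, fun g q hq => by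
    rw [Pi.add_apply, Pi.add_apply, map_add, ha.2 g q hq, hb.2 g q hq]⟩
  zero_mem' := ⟨zero_mem _, fun g q _ => by simp⟩
  smul_mem' := fun c _ ha => ⟨Submodule.smul_mem _ c ha.1, fun g q hq => by
    rw [Pi.smul_apply, Pi.smul_apply, map_smul, ha.2 g q hq]⟩

/-- Sections over `U` of `𝒜_D(P) = (d'p)⁻¹(TX(-log D))`. The kernel of its projection to
`TX(-log D)` consists of the vertical invariant fields, that is, of the sections of the adjoint
bundle. -/
def LogAt (D : ReducedDivisor V X) (U : Opens X) : Submodule ℂ (Π q : P, TangentSpace J q) where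
  carrier := {ξ | ξ ∈ At J p G U ∧ ∃ v ∈ TLog D U, ProjectsTo J p U ξ v}
  add_mem' := by
    rintro a b ⟨ha, v, hv, hav⟩ ⟨hb, w, hw, hbw⟩
    exact ⟨add_mem ha hb, v + w, add_mem hv hw, hav.add hbw⟩
  zero_mem' := ⟨zero_mem _, 0, zero_mem _, fun q _ => by simp⟩
  smul_mem' := by
    rintro c a ⟨ha, v, hv, hav⟩
    exact ⟨Submodule.smul_mem _ c ha, c • v, Submodule.smul_mem _ c hv, hav.smul c⟩

/-- The projection `d'p : 𝒜_D(P) → TX(-log D)` on sections over `U`. -/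
def logProj (hp : Function.Surjective p) (D : ReducedDivisor V X) (U : Opens X) :
    LogAt J p G D U →ₗ[ℂ] TLog D U where
  toFun ξ := ⟨ξ.2.2.choose, ξ.2.2.choose_spec.1⟩
  map_add' ξ ζ := Subtype.ext <| ProjectsTo.unique hp (ξ + ζ).2.2.choose_spec.1
    (add_mem ξ.2.2.choose_spec.1 ζ.2.2.choose_spec.1) (ξ + ζ).2.2.choose_spec.2
    (ξ.2.2.choose_spec.2.add ζ.2.2.choose_spec.2)
  map_smul' c ξ := Subtype.ext <| ProjectsTo.unique hp (c • ξ).2.2.choose_spec.1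
    (Submodule.smul_mem _ c ξ.2.2.choose_spec.1) (c • ξ).2.2.choose_spec.2
    (ξ.2.2.choose_spec.2.smul c)

theorem logProj_spec (hp : Function.Surjective p) (D : ReducedDivisor V X) (U : Opens X)
    (ξ : LogAt J p G D U) : ProjectsTo J p U ξ.1 (logProj J p G hp D U ξ).1 :=
  ξ.2.2.choose_spec.2

/-- A holomorphic splitting of `0 → ad(P) → 𝒜_D(P) → TX(-log D) → 0`: a homomorphism of sheaves of
`𝒪_X`-modules `η : TX(-log D) → 𝒜_D(P)` with `d'p ∘ η = id`. -/
structure LogAtiyahSplitting (hp : Function.Surjective p) (D : ReducedDivisor V X) where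
  eta : ∀ U : Opens X, TLog D U →ₗ[ℂ] LogAt J p G D U
  smul : ∀ (U : Opens X) (f : X → ℂ) (hf : ContMDiffOn 𝓘(ℂ, V) 𝓘(ℂ) ω f U) (v : TLog D U)
    (q : P), (eta U ⟨fun x => f x • v.1 x, TLog.smul_mem hf v.2⟩).1 q = f (p q) • (eta U v).1 q
  restrict : ∀ (U W : Opens X) (hWU : W ≤ U) (v : TLog D U),
    (eta W ⟨restrictTo W v.1, TLog.restrict_mem hWU v.2⟩).1 =
      restrictTo (W.comap p) (eta U v).1
  section_eq : ∀ U : Opens X, (logProj J p G hp D U) ∘ₗ (eta U) = LinearMap.id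

end Atiyah

end Base

/-! ### The frame bundle -/

section Frame

/-- The total space of the bundle `Hom(ℂⁿ, E)`. -/
abbrev HomTotal (n : ℕ) {X : Type*} (E : X → Type*) [∀ x, AddCommGroup (E x)]
    [∀ x, Module ℂ (E x)] [∀ x, TopologicalSpace (E x)] : Type _ :=
  TotalSpace ((Fin n → ℂ) →L[ℂ] (Fin n → ℂ)) (fun x => Trivial X (Fin n → ℂ) x →L[ℂ] E x)

variable (n : ℕ) {X : Type*} [TopologicalSpace X]
  (E : X → Type*) [TopologicalSpace (TotalSpace (Fin n → ℂ) E)]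
  [∀ x, AddCommGroup (E x)] [∀ x, Module ℂ (E x)] [∀ x, TopologicalSpace (E x)]
  [∀ x, IsTopologicalAddGroup (E x)] [∀ x, ContinuousSMul ℂ (E x)]
  [FiberBundle (Fin n → ℂ) E] [VectorBundle ℂ (Fin n → ℂ) E]

theorem isOpen_bijective :
    IsOpen {A : (Fin n → ℂ) →L[ℂ] (Fin n → ℂ) | Function.Bijective A} := by
  convert ContinuousLinearEquiv.isOpen (𝕜 := ℂ) (E := Fin n → ℂ) (F := Fin n → ℂ) using 1
  ext A
  constructor
  · intro h
    exact ⟨ContinuousLinearEquiv.ofBijective A (LinearMap.ker_eq_bot.2 h.1)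
      (LinearMap.range_eq_top.2 h.2), by ext; simp⟩
  · rintro ⟨e, rfl⟩
    exact e.bijective

theorem isOpen_frames :
    IsOpen {q : HomTotal n E | Function.Bijective (q.2 : (Fin n → ℂ) → E q.1)} := by
  rw [isOpen_iff_mem_nhds]
  intro q₀ hq₀
  let Φ := trivializationAt ((Fin n → ℂ) →L[ℂ] (Fin n → ℂ))
    (fun x => Trivial X (Fin n → ℂ) x →L[ℂ] E x) q₀.1
  let e := trivializationAt (Fin n → ℂ) E q₀.1
  have key : ∀ q ∈ Φ.source, (Function.Bijective (Φ q).2 ↔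
      Function.Bijective (q.2 : (Fin n → ℂ) → E q.1)) := by
    intro q hq
    have hb : q.1 ∈ e.baseSet := by
      have := Φ.mem_source.1 hq
      rw [hom_trivializationAt_baseSet] at this
      exact this.2
    have h1 : (Φ q).2 = _ := congrArg Prod.snd
      (hom_trivializationAt_apply (RingHom.id ℂ) q₀.1 q)
    rw [h1, ContinuousLinearMap.inCoordinates_eq (by simp) hb]
    exact ((e.continuousLinearEquivAt ℂ q.1 hb).bijective.of_comp_iff' _).trans
      (Function.Bijective.of_comp_iff _ (ContinuousLinearEquiv.bijective _))
  have h0 : q₀ ∈ Φ.source := FiberBundle.mem_trivializationAt_proj_source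
  have hc : ContinuousAt (fun q => (Φ q).2) q₀ :=
    continuous_snd.continuousAt.comp (Φ.continuousOn.continuousAt (Φ.open_source.mem_nhds h0))
  filter_upwards [hc ((isOpen_bijective n).mem_nhds ((key q₀ h0).2 hq₀)),
    Φ.open_source.mem_nhds h0] with q h1 h2
  exact (key q h2).1 h1

/-- The frame bundle of `E`, as an open submanifold of the total space of `Hom(ℂⁿ, E)`: a frame at
`x` is a linear isomorphism `ℂⁿ → E_x`. -/
def frames : Opens (HomTotal n E) :=
  ⟨{q | Function.Bijective (q.2 : (Fin n → ℂ) → E q.1)}, isOpen_frames n E⟩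

/-- The automorphism of `ℂⁿ` defined by an invertible matrix. -/
def glMap {n : ℕ} (g : GL (Fin n) ℂ) : (Fin n → ℂ) →L[ℂ] (Fin n → ℂ) :=
  LinearMap.toContinuousLinearMap (Matrix.toLin' (g : Matrix (Fin n) (Fin n) ℂ))

theorem glMap_apply {n : ℕ} (g : GL (Fin n) ℂ) (v : Fin n → ℂ) :
    glMap g v = (g : Matrix (Fin n) (Fin n) ℂ) *ᵥ v := rfl

theorem glMap_bijective {n : ℕ} (g : GL (Fin n) ℂ) : Function.Bijective (glMap g) := by
  refine Function.bijective_iff_has_inverse.2 ⟨glMap g⁻¹, fun v => ?_, fun v => ?_⟩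
  · rw [glMap_apply, glMap_apply, Matrix.mulVec_mulVec, ← Matrix.GeneralLinearGroup.coe_mul,
      inv_mul_cancel, Matrix.GeneralLinearGroup.coe_one, Matrix.one_mulVec]
  · rw [glMap_apply, glMap_apply, Matrix.mulVec_mulVec, ← Matrix.GeneralLinearGroup.coe_mul,
      mul_inv_cancel, Matrix.GeneralLinearGroup.coe_one, Matrix.one_mulVec]

/-- The right action of `GL_n(ℂ)` on frames: `(x, u) · g = (x, u ∘ g)`. -/
instance frameAction : MulAction (GL (Fin n) ℂ)ᵐᵒᵖ (frames n E) where
  smul g q := ⟨⟨q.1.1, ContinuousLinearMap.comp (q.1.2 : (Fin n → ℂ) →L[ℂ] E q.1.1)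
    (glMap g.unop)⟩, q.2.comp (glMap_bijective g.unop)⟩
  one_smul q := by
    refine Subtype.ext (TotalSpace.ext rfl (heq_of_eq ?_))
    refine ContinuousLinearMap.ext fun v => ?_
    change q.1.2 (glMap (1 : GL (Fin n) ℂ) v) = q.1.2 v
    rw [glMap_apply, Matrix.GeneralLinearGroup.coe_one, Matrix.one_mulVec]
  mul_smul g h q := by
    refine Subtype.ext (TotalSpace.ext rfl (heq_of_eq ?_))
    refine ContinuousLinearMap.ext fun v => ?_
    change q.1.2 (glMap (h.unop * g.unop) v) = q.1.2 (glMap h.unop (glMap g.unop v))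
    rw [glMap_apply, glMap_apply, glMap_apply, Matrix.mulVec_mulVec,
      ← Matrix.GeneralLinearGroup.coe_mul]

/-- The projection of the frame bundle. -/
def frameProj : C(frames n E, X) where
  toFun q := q.1.1
  continuous_toFun := (FiberBundle.continuous_proj _ _).comp continuous_subtype_val

theorem frameProj_surjective : Function.Surjective (frameProj n E) := fun x =>
  ⟨⟨⟨x, ((VectorBundle.continuousLinearEquivAt ℂ (Fin n → ℂ) E x).symm :
    (Fin n → ℂ) →L[ℂ] E x)⟩,
    (VectorBundle.continuousLinearEquivAt ℂ (Fin n → ℂ) E x).symm.bijective⟩, rfl⟩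

end Frame

end LogAtiyah

end

/-! Both structures carry the same local data. In each preferred trivialization of `E` take a
matrix-valued 1-form A off D. On overlaps with transition matrix T, require dT + A₁T = TA₀. Require
also that A(v) extend holomorphically across D for every logarithmic field v. `ConnectionForms`
records exactly this, and each side of the equivalence is passed to it and recovered from it. Only
existence is claimed, so the passages need not be shown to be mutually inverse.

Connections: locality and the Leibniz rule force ∇ = d + A in a trivialization
(`LogConnection.toTriv_nabla`), and A(v) extends because a logarithmic form pairs holomorphically
with v. Conversely the local operators d + A agree by the gauge rule, but ∇s must be shown to lie in
E ⊗ Ω¹(log D), although A is controlled only through its values on logarithmic fields. This is the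
reflexivity statement `isLogForm_of_extendsAt`. If f is a local equation of D, the fields f·u and
df(u)w − df(w)u are logarithmic for all holomorphic u and w. On them α takes the values (fα)(u) and
(df ∧ α)(u, w). Since f dα = d(fα) − df ∧ α, both simple-pole conditions can be read off from these
values. No assumption on the singularities of D enters.

Splittings: a trivialization gives the frame bundle coordinates (x, C) with C an invertible matrix,
and the group multiplies C on the right. The horizontal lift of v has components (v, −A(v)C). This
is right-invariant, and the gauge rule makes it independent of the trivialization; across D the rule
persists by density. Conversely, off D every vector field is logarithmic, so a splitting is
pointwise there (`LogAtiyahSplitting.eta_eq_hor`). Minus its C-component at C = 1 defines A,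
invariance determines the component at every other frame
(`LogAtiyahSplitting.mvfderiv_frameCoord_hor`), and differentiating C₁ = TC₀ gives the gauge rule.
-/

noncomputable section

namespace LogAtiyah

/-! ### Linear maps out of finite-dimensional spaces and their values -/

section Rebuild

variable {W Z : Type*} [NormedAddCommGroup W] [NormedSpace ℂ W] [FiniteDimensional ℂ W]
  [NormedAddCommGroup Z] [NormedSpace ℂ Z]

variable (W Z) in
/-- A linear map is determined by its values on a basis, continuously and linearly. -/
def ofBasisValues : (Fin (Module.finrank ℂ W) → Z) →L[ℂ] (W →L[ℂ] Z) :=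
  ∑ i, (ContinuousLinearMap.smulRightL ℂ W Z
    (LinearMap.toContinuousLinearMap ((Module.finBasis ℂ W).coord i))).comp
      (ContinuousLinearMap.proj i)

theorem ofBasisValues_apply (A : W →L[ℂ] Z) :
    ofBasisValues W Z (fun i => A (Module.finBasis ℂ W i)) = A := by
  ext w
  conv_rhs => rw [← (Module.finBasis ℂ W).sum_repr w, map_sum]
  simp [ofBasisValues]

/-- Finitely many values, those on a basis, determine the operator linearly. This reduces
operator-valued holomorphy to testing on single vectors. -/
theorem contMDiffAt_clm_of_apply {B : Type*} [NormedAddCommGroup B] [NormedSpace ℂ B] {H : Type*}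
    [TopologicalSpace H] {J : ModelWithCorners ℂ B H} {M : Type*} [TopologicalSpace M]
    [ChartedSpace H M] {f : M → W →L[ℂ] Z} {x : M}
    (h : ∀ w, ContMDiffAt J 𝓘(ℂ, Z) ω (fun y => f y w) x) :
    ContMDiffAt J 𝓘(ℂ, W →L[ℂ] Z) ω f x := by
  have : f = fun y => ofBasisValues W Z (fun i => f y (Module.finBasis ℂ W i)) := by
    funext y; rw [ofBasisValues_apply]
  rw [this]
  exact (ofBasisValues W Z).contMDiff.contMDiffAt.comp x (contMDiffAt_pi_space.2 fun i => h _)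

end Rebuild

/-! ### Derivatives along vector fields -/

section Derivative

variable {B : Type*} [NormedAddCommGroup B] [NormedSpace ℂ B] {H : Type*} [TopologicalSpace H]
  {J : ModelWithCorners ℂ B H} {M : Type*} [TopologicalSpace M] [ChartedSpace H M]
  [IsManifold J ω M]
  {Z : Type*} [NormedAddCommGroup Z] [NormedSpace ℂ Z]

/-- The derivative of a holomorphic function along a holomorphic vector field is holomorphic. -/
theorem contMDiffAt_mvfderiv_apply {f : M → Z} {v : Π x : M, TangentSpace J x} {x : M}
    (hf : ContMDiffAt J 𝓘(ℂ, Z) ω f x)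
    (hv : ContMDiffAt J (J.prod 𝓘(ℂ, B)) ω (fun y => TotalSpace.mk' B y (v y)) x) :
    ContMDiffAt J 𝓘(ℂ, Z) ω (fun y => mvfderiv J f y (v y)) x := by
  have h1 := hf.mfderiv_const (m := ω) (by simp)
  have h2 := ContMDiffAt.clm_apply_of_inCoordinates (F₁ := B) (F₂ := Z)
    (E₁ := (TangentSpace J : M → Type _)) (E₂ := (TangentSpace 𝓘(ℂ, Z) : Z → Type _))
    (b₁ := id) (b₂ := f) (ϕ := fun y => mfderiv J 𝓘(ℂ, Z) f y) (v := v) h1 hv hf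
  exact (contMDiff_snd_tangentBundle_modelSpace Z 𝓘(ℂ, Z)).contMDiffAt.comp x h2

end Derivative

/-! ### Holomorphic extension across a divisor -/

section Extension

variable {V : Type*} [NormedAddCommGroup V] [NormedSpace ℂ V]
  {X : Type*} [TopologicalSpace X] [ChartedSpace V X] (D : ReducedDivisor V X)

theorem ReducedDivisor.dense_compl : Dense D.suppᶜ :=
  interior_eq_empty_iff_dense_compl.1 D.nowhereDense

variable {D}

theorem ReducedDivisor.mem_away {U : Opens X} {x : X} :
    x ∈ D.away U ↔ x ∈ U ∧ x ∉ D.supp := Iff.rfl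

theorem ReducedDivisor.away_le {U : Opens X} : D.away U ≤ U := fun _ h => h.1

theorem ReducedDivisor.away_mono {U W : Opens X} (h : W ≤ U) : D.away W ≤ D.away U :=
  fun _ hx => ⟨h hx.1, hx.2⟩

theorem ReducedDivisor.eventually_notMem {x : X} (hx : x ∉ D.supp) : ∀ᶠ z in 𝓝 x, z ∉ D.supp :=
  D.isClosed.isOpen_compl.mem_nhds hx

variable {Z Z' Z'' : Type*} [NormedAddCommGroup Z] [NormedSpace ℂ Z] [NormedAddCommGroup Z']
  [NormedSpace ℂ Z'] [NormedAddCommGroup Z''] [NormedSpace ℂ Z'']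

variable (D) in
/-- `f`, as a function on the complement of `D`, extends holomorphically to a neighbourhood
of `x`. -/
def ExtendsAt (f : X → Z) (x : X) : Prop :=
  ∃ h : X → Z, ContMDiffAt 𝓘(ℂ, V) 𝓘(ℂ, Z) ω h x ∧ ∀ᶠ z in 𝓝 x, z ∉ D.supp → h z = f z

variable (D) in
/-- The extension by continuity across `D`. -/
def extend (f : X → Z) : X → Z := extendFrom D.suppᶜ f

/-- D is nowhere dense, so every point is a limit of points off D and the limit of f along them is
unique. Where no such limit exists, `extend` has an arbitrary value. -/
theorem extend_eq_of_continuousAt {f h : X → Z} {x : X} (hh : ContinuousAt h x)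
    (hf : ∀ᶠ z in 𝓝 x, z ∉ D.supp → h z = f z) : extend D f x = h x := by
  refine extendFrom_eq (D.dense_compl x) ?_
  refine (hh.tendsto.mono_left nhdsWithin_le_nhds).congr' ?_
  exact eventually_nhdsWithin_iff.2 hf

/-- The density principle by which identities known only off D are carried across D. -/
theorem eq_of_eventually_notMem {f h : X → Z} {x : X} (hf : ContinuousAt f x)
    (hh : ContinuousAt h x) (hfh : ∀ᶠ z in 𝓝 x, z ∉ D.supp → f z = h z) : f x = h x := by
  rw [← extend_eq_of_continuousAt hf (f := h) hfh,
    extend_eq_of_continuousAt hh (Filter.Eventually.of_forall fun _ _ => rfl)]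

theorem ExtendsAt.congr {f g : X → Z} {x : X} (hf : ExtendsAt D f x)
    (hfg : ∀ᶠ z in 𝓝 x, z ∉ D.supp → f z = g z) : ExtendsAt D g x := by
  obtain ⟨h, hh, hhf⟩ := hf
  refine ⟨h, hh, ?_⟩
  filter_upwards [hhf, hfg] with z h1 h2 hz
  rw [h1 hz, h2 hz]

theorem extend_congr {f g : X → Z} {x : X} (hf : ExtendsAt D f x)
    (hfg : ∀ᶠ z in 𝓝 x, z ∉ D.supp → f z = g z) : extend D f x = extend D g x := by
  obtain ⟨h, hh, hhf⟩ := hf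
  rw [extend_eq_of_continuousAt hh.continuousAt hhf, extend_eq_of_continuousAt hh.continuousAt]
  filter_upwards [hhf, hfg] with z h1 h2 hz
  rw [h1 hz, h2 hz]

theorem _root_.ContMDiffAt.extendsAt {f : X → Z} {x : X}
    (hf : ContMDiffAt 𝓘(ℂ, V) 𝓘(ℂ, Z) ω f x) : ExtendsAt D f x :=
  ⟨f, hf, Filter.Eventually.of_forall fun _ _ => rfl⟩

theorem ExtendsAt.contMDiffAt {f : X → Z} {x : X} (hf : ExtendsAt D f x) (hx : x ∉ D.supp) :
    ContMDiffAt 𝓘(ℂ, V) 𝓘(ℂ, Z) ω f x := by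
  obtain ⟨h, hh, hhf⟩ := hf
  refine hh.congr_of_eventuallyEq ?_
  filter_upwards [hhf, D.eventually_notMem hx] with z h1 h2
  exact (h1 h2).symm

theorem ExtendsAt.clm_comp {f : X → Z} {x : X} (hf : ExtendsAt D f x) (L : Z →L[ℂ] Z') :
    ExtendsAt D (fun z => L (f z)) x := by
  obtain ⟨h, hh, hhf⟩ := hf
  refine ⟨fun z => L (h z), L.contMDiff.contMDiffAt.comp x hh, ?_⟩
  filter_upwards [hhf] with z h1 hz
  rw [h1 hz]

theorem ExtendsAt.add {f g : X → Z} {x : X} (hf : ExtendsAt D f x) (hg : ExtendsAt D g x) :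
    ExtendsAt D (fun z => f z + g z) x := by
  obtain ⟨h, hh, hhf⟩ := hf
  obtain ⟨k, hk, hkg⟩ := hg
  refine ⟨fun z => h z + k z, hh.add hk, ?_⟩
  filter_upwards [hhf, hkg] with z h1 h2 hz
  rw [h1 hz, h2 hz]

theorem ExtendsAt.clm_apply {f : X → Z →L[ℂ] Z'} {g : X → Z} {x : X} (hf : ExtendsAt D f x)
    (hg : ExtendsAt D g x) : ExtendsAt D (fun z => f z (g z)) x := by
  obtain ⟨h, hh, hhf⟩ := hf
  obtain ⟨k, hk, hkg⟩ := hg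
  refine ⟨fun z => h z (k z), hh.clm_apply hk, ?_⟩
  filter_upwards [hhf, hkg] with z h1 h2 hz
  rw [h1 hz, h2 hz]

theorem ExtendsAt.smul {f : X → ℂ} {g : X → Z} {x : X} (hf : ExtendsAt D f x)
    (hg : ExtendsAt D g x) : ExtendsAt D (fun z => f z • g z) x := by
  obtain ⟨h, hh, hhf⟩ := hf
  obtain ⟨k, hk, hkg⟩ := hg
  refine ⟨fun z => h z • k z, hh.smul hk, ?_⟩
  filter_upwards [hhf, hkg] with z h1 h2 hz
  rw [h1 hz, h2 hz]

theorem ExtendsAt.sum {ι : Type*} (s : Finset ι) {f : ι → X → Z} {x : X}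
    (hf : ∀ i ∈ s, ExtendsAt D (f i) x) : ExtendsAt D (fun z => ∑ i ∈ s, f i z) x := by
  classical
  induction s using Finset.induction_on with
  | empty => simpa using (contMDiffAt_const (c := (0 : Z))).extendsAt
  | insert a s ha ih =>
    simp only [Finset.sum_insert ha]
    exact (hf a (by simp)).add (ih fun i hi => hf i (by simp [hi]))

theorem ExtendsAt.pi {ι : Type*} [Fintype ι] {f : X → ι → Z} {x : X}
    (hf : ∀ i, ExtendsAt D (fun z => f z i) x) : ExtendsAt D f x := by
  choose h hh hhf using hf
  refine ⟨fun z i => h i z, contMDiffAt_pi_space.2 hh, ?_⟩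
  filter_upwards [Filter.eventually_all.2 hhf] with z h1 hz
  funext i
  exact h1 i hz

theorem ExtendsAt.clm_of_apply [FiniteDimensional ℂ Z] {f : X → Z →L[ℂ] Z'} {x : X}
    (hf : ∀ w, ExtendsAt D (fun z => f z w) x) : ExtendsAt D f x := by
  have : f = fun y => ofBasisValues Z Z' (fun i => f y (Module.finBasis ℂ Z i)) := by
    funext y; rw [ofBasisValues_apply]
  rw [this]
  exact (ExtendsAt.pi fun i => hf _).clm_comp _

variable [IsManifold 𝓘(ℂ, V) ω X]

theorem ExtendsAt.eventually {f : X → Z} {x : X} (hf : ExtendsAt D f x) :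
    ∀ᶠ z in 𝓝 x, ExtendsAt D f z := by
  obtain ⟨h, hh, hhf⟩ := hf
  filter_upwards [(contMDiffAt_iff_contMDiffAt_nhds (by simp)).1 hh,
    eventually_eventually_nhds.2 hhf] with z h1 h2
  exact ⟨h, h1, h2⟩

theorem ExtendsAt.extend_contMDiffAt {f : X → Z} {x : X} (hf : ExtendsAt D f x) :
    ContMDiffAt 𝓘(ℂ, V) 𝓘(ℂ, Z) ω (extend D f) x := by
  obtain ⟨h, hh, hhf⟩ := hf
  refine hh.congr_of_eventuallyEq ?_
  filter_upwards [(contMDiffAt_iff_contMDiffAt_nhds (by simp)).1 hh,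
    eventually_eventually_nhds.2 hhf] with z h1 h2
  exact extend_eq_of_continuousAt h1.continuousAt h2

theorem ExtendsAt.extend_eq {f : X → Z} {x : X} (hf : ExtendsAt D f x) (hx : x ∉ D.supp) :
    extend D f x = f x :=
  extend_eq_of_continuousAt (hf.contMDiffAt hx).continuousAt
    (Filter.Eventually.of_forall fun _ _ => rfl)

theorem ExtendsAt.eventually_extend_eq {f : X → Z} {x : X} (hf : ExtendsAt D f x) :
    ∀ᶠ z in 𝓝 x, z ∉ D.supp → extend D f z = f z := by
  filter_upwards [hf.eventually] with z h1 hz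
  exact h1.extend_eq hz

/-- Local extensions are unique, hence glue; the global one is `extend D f`. Membership in `TLog`
thereby becomes a condition at each point. -/
theorem exists_contMDiffOn_iff_extendsAt {W : Opens X} {f : X → Z} :
    (∃ h : X → Z, ContMDiffOn 𝓘(ℂ, V) 𝓘(ℂ, Z) ω h W ∧ ∀ x ∈ W, x ∉ D.supp → h x = f x) ↔
      ∀ x ∈ W, ExtendsAt D f x := by
  constructor
  · rintro ⟨h, hh, hhf⟩ x hx
    refine ⟨h, hh.contMDiffAt (W.2.mem_nhds hx), ?_⟩
    filter_upwards [W.2.mem_nhds hx] with z hz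
    exact hhf z hz
  · intro h
    exact ⟨extend D f, fun x hx => (h x hx).extend_contMDiffAt.contMDiffWithinAt,
      fun x hx hxD => (h x hx).extend_eq hxD⟩

end Extension

end LogAtiyah

end

noncomputable section

namespace LogAtiyah

/-! ### Sections in a trivialization -/

section Trivializations

variable {B : Type*} [NormedAddCommGroup B] [NormedSpace ℂ B] {H : Type*} [TopologicalSpace H]
  {J : ModelWithCorners ℂ B H} {M : Type*} [TopologicalSpace M] [ChartedSpace H M]
  (F : Type*) [NormedAddCommGroup F] [NormedSpace ℂ F]
  (E : M → Type*) [TopologicalSpace (TotalSpace F E)]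
  [∀ x, AddCommGroup (E x)] [∀ x, Module ℂ (E x)] [∀ x, TopologicalSpace (E x)]
  [FiberBundle F E] [VectorBundle ℂ F E]

/-- The fibre coordinate at `z` of the preferred trivialization at `x₀`. -/
def toTriv (x₀ z : M) : E z →L[ℂ] F := (trivializationAt F E x₀).continuousLinearMapAt ℂ z

/-- The inverse of the fibre coordinate at `z` of the preferred trivialization at `x₀`. -/
def ofTriv (x₀ z : M) : F →L[ℂ] E z := (trivializationAt F E x₀).symmL ℂ z

/-- The domain of the preferred trivialization at `x₀`. -/
def baseOpen (x₀ : M) : Opens M :=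
  ⟨(trivializationAt F E x₀).baseSet, (trivializationAt F E x₀).open_baseSet⟩

variable {E}

theorem mem_baseOpen_self (x : M) : x ∈ baseOpen F E x := mem_baseSet_trivializationAt F E x

variable {F}

@[simp]
theorem ofTriv_toTriv {x₀ z : M} (hz : z ∈ baseOpen F E x₀) (s : E z) :
    ofTriv F E x₀ z (toTriv F E x₀ z s) = s :=
  (trivializationAt F E x₀).symmL_continuousLinearMapAt hz s

@[simp]
theorem toTriv_ofTriv {x₀ z : M} (hz : z ∈ baseOpen F E x₀) (w : F) :
    toTriv F E x₀ z (ofTriv F E x₀ z w) = w :=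
  (trivializationAt F E x₀).continuousLinearMapAt_symmL hz w

theorem toTriv_eq_snd {x₀ z : M} (hz : z ∈ baseOpen F E x₀) (s : E z) :
    toTriv F E x₀ z s = (trivializationAt F E x₀ ⟨z, s⟩).2 := by
  rw [toTriv, Trivialization.continuousLinearMapAt_apply, Trivialization.linearMapAt_apply]
  exact if_pos hz

theorem toTriv_injective {x₀ z : M} (hz : z ∈ baseOpen F E x₀) :
    Function.Injective (toTriv F E x₀ z) :=
  Function.LeftInverse.injective (ofTriv_toTriv hz)

variable (F E) in
/-- The transition matrix from the trivialization at `x₀` to the one at `x₁`. -/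
def transition (x₀ x₁ z : M) : F →L[ℂ] F := (toTriv F E x₁ z).comp (ofTriv F E x₀ z)

theorem transition_toTriv {x₀ x₁ z : M} (h₀ : z ∈ baseOpen F E x₀) (s : E z) :
    transition F E x₀ x₁ z (toTriv F E x₀ z s) = toTriv F E x₁ z s := by
  simp [transition, h₀]

theorem baseOpen_mem_nhds {x₀ x : M} (hx : x ∈ baseOpen F E x₀) :
    ∀ᶠ z in 𝓝 x, z ∈ baseOpen F E x₀ := (baseOpen F E x₀).2.mem_nhds hx

variable [ContMDiffVectorBundle ω F E J]

theorem contMDiffAt_transition {x₀ x₁ x : M} (h₀ : x ∈ baseOpen F E x₀)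
    (h₁ : x ∈ baseOpen F E x₁) : ContMDiffAt J 𝓘(ℂ, F →L[ℂ] F) ω (transition F E x₀ x₁) x := by
  refine (contMDiffAt_coordChangeL (F := F) (E := E) (n := ω) (e := trivializationAt F E x₀)
    (e' := trivializationAt F E x₁) h₀ h₁).congr_of_eventuallyEq ?_
  filter_upwards [baseOpen_mem_nhds h₀, baseOpen_mem_nhds h₁] with z hz₀ hz₁
  ext w
  have h := (trivializationAt F E x₀).coordChangeL_apply (R := ℂ) (trivializationAt F E x₁)
    ⟨hz₀, hz₁⟩ w
  rw [transition, ContinuousLinearMap.comp_apply, toTriv_eq_snd hz₁, ofTriv,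
    Trivialization.symmL_apply]
  exacts [h.symm, hz₀]

theorem contMDiffAt_section_iff_toTriv {s : Π x, E x} {x₀ x : M} (hx : x ∈ baseOpen F E x₀) :
    ContMDiffAt J (J.prod 𝓘(ℂ, F)) ω (fun z => TotalSpace.mk' F z (s z)) x ↔
      ContMDiffAt J 𝓘(ℂ, F) ω (fun z => toTriv F E x₀ z (s z)) x := by
  rw [(trivializationAt F E x₀).contMDiffAt_section_iff hx]
  refine Filter.EventuallyEq.contMDiffAt_iff ?_
  filter_upwards [baseOpen_mem_nhds hx] with z hz
  rw [toTriv_eq_snd hz]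

theorem contMDiffAt_ofTriv {x₀ x : M} (hx : x ∈ baseOpen F E x₀) {f : M → F}
    (hf : ContMDiffAt J 𝓘(ℂ, F) ω f x) :
    ContMDiffAt J (J.prod 𝓘(ℂ, F)) ω (fun z => TotalSpace.mk' F z (ofTriv F E x₀ z (f z))) x := by
  rw [contMDiffAt_section_iff_toTriv hx]
  refine hf.congr_of_eventuallyEq ?_
  filter_upwards [baseOpen_mem_nhds hx] with z hz
  rw [toTriv_ofTriv hz]

theorem Sec.contMDiffAt {U : Opens M} {s : Π x, E x} (hs : s ∈ Sec J F E U) {x : M} (hx : x ∈ U) :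
    ContMDiffAt J (J.prod 𝓘(ℂ, F)) ω (fun z => TotalSpace.mk' F z (s z)) x :=
  hs.1.contMDiffAt (U.2.mem_nhds hx)

theorem Sec.contMDiffAt_toTriv {U : Opens M} {s : Π x, E x} (hs : s ∈ Sec J F E U) {x₀ x : M}
    (hx : x ∈ U) (hx₀ : x ∈ baseOpen F E x₀) :
    ContMDiffAt J 𝓘(ℂ, F) ω (fun z => toTriv F E x₀ z (s z)) x :=
  (contMDiffAt_section_iff_toTriv hx₀).1 (Sec.contMDiffAt hs hx)

@[simp]
theorem restrictTo_of_mem {U : Opens M} (s : Π x, E x) {x : M} (hx : x ∈ U) :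
    restrictTo U s x = s x := if_pos hx

theorem restrictTo_of_notMem {U : Opens M} (s : Π x, E x) {x : M} (hx : x ∉ U) :
    restrictTo U s x = 0 := if_neg hx

theorem restrictTo_mem_sec {U : Opens M} {s : Π x, E x}
    (hs : ∀ x ∈ U, ContMDiffAt J (J.prod 𝓘(ℂ, F)) ω (fun z => TotalSpace.mk' F z (s z)) x) :
    restrictTo U s ∈ Sec J F E U := by
  refine ⟨fun x hx => ((hs x hx).contMDiffWithinAt).congr (fun z hz => ?_) ?_,
    fun x hx => restrictTo_of_notMem s hx⟩
  · rw [restrictTo_of_mem s hz]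
  · rw [restrictTo_of_mem s hx]

end Trivializations

/-! ### Holomorphy of sections of Hom bundles -/

section HomBundle

variable {B : Type*} [NormedAddCommGroup B] [NormedSpace ℂ B] {H : Type*} [TopologicalSpace H]
  {J : ModelWithCorners ℂ B H} {M : Type*} [TopologicalSpace M] [ChartedSpace H M]
  {F₁ F₂ : Type*} [NormedAddCommGroup F₁] [NormedSpace ℂ F₁] [FiniteDimensional ℂ F₁]
  [NormedAddCommGroup F₂] [NormedSpace ℂ F₂]
  {E₁ E₂ : M → Type*} [TopologicalSpace (TotalSpace F₁ E₁)]
  [∀ x, AddCommGroup (E₁ x)] [∀ x, Module ℂ (E₁ x)] [∀ x, TopologicalSpace (E₁ x)]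
  [FiberBundle F₁ E₁] [VectorBundle ℂ F₁ E₁]
  [TopologicalSpace (TotalSpace F₂ E₂)]
  [∀ x, AddCommGroup (E₂ x)] [∀ x, Module ℂ (E₂ x)] [∀ x, TopologicalSpace (E₂ x)]
  [FiberBundle F₂ E₂] [VectorBundle ℂ F₂ E₂]
  [∀ x, IsTopologicalAddGroup (E₂ x)] [∀ x, ContinuousSMul ℂ (E₂ x)]

theorem contMDiffAt_hom_of_apply {φ : Π x, E₁ x →L[ℂ] E₂ x} {x : M}
    (h : ∀ w, ContMDiffAt J 𝓘(ℂ, F₂) ω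
      (fun z => toTriv F₂ E₂ x z (φ z (ofTriv F₁ E₁ x z w))) x) :
    ContMDiffAt J (J.prod 𝓘(ℂ, F₁ →L[ℂ] F₂)) ω
      (fun z => TotalSpace.mk' (F₁ →L[ℂ] F₂) (E := fun x => E₁ x →L[ℂ] E₂ x) z (φ z)) x :=
  contMDiffAt_hom_bundle _ |>.2 ⟨contMDiffAt_id, contMDiffAt_clm_of_apply h⟩

end HomBundle

section TrivialBundle

variable {M : Type*} [TopologicalSpace M] {F : Type*} [NormedAddCommGroup F] [NormedSpace ℂ F]

@[simp]
theorem toTriv_trivial (x z : M) : toTriv F (Trivial M F) x z = ContinuousLinearMap.id ℂ F :=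
  Trivial.continuousLinearMapAt_trivialization ℂ M F z

end TrivialBundle

end LogAtiyah

end

noncomputable section

namespace LogAtiyah

/-! ### One-forms on vector spaces -/

section OneForms

variable {V : Type*} [NormedAddCommGroup V] [NormedSpace ℂ V]

theorem extDeriv_ofSubsingleton_apply {κ : V → V →L[ℂ] ℂ} {y : V} (hκ : DifferentiableAt ℂ κ y)
    (u w : V) :
    extDeriv (fun z => ContinuousAlternatingMap.ofSubsingleton ℂ V ℂ (0 : Fin 1) (κ z)) y ![u, w] =
      fderiv ℂ κ y u w - fderiv ℂ κ y w u := by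
  have h : DifferentiableAt ℂ
      (fun z => ContinuousAlternatingMap.ofSubsingleton ℂ V ℂ (0 : Fin 1) (κ z)) y :=
    (ContinuousAlternatingMap.ofSubsingletonLIE (𝕜 := ℂ) (E := V) (F := ℂ) (0 : Fin 1)).differentiableAt.comp y hκ
  rw [extDeriv_apply h]
  have hc : ∀ v t : V, fderiv ℂ (fun z => κ z v) y t = fderiv ℂ κ y t v := fun v t => by
    rw [fderiv_clm_apply hκ (differentiableAt_const v)]
    simp
  simp [Fin.sum_univ_two, Fin.removeNth, hc, sub_eq_add_neg]

/-- The Leibniz rule d(fκ) = df ∧ κ + f dκ, solved for f dκ and evaluated on (u, w). -/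
theorem smul_extDeriv_apply {κ : V → V →L[ℂ] ℂ} {f : V → ℂ} {y : V}
    (hκ : DifferentiableAt ℂ κ y) (hf : DifferentiableAt ℂ f y) (u w : V) :
    f y * extDeriv (fun z => ContinuousAlternatingMap.ofSubsingleton ℂ V ℂ (0 : Fin 1) (κ z)) y
        ![u, w] =
      fderiv ℂ (fun z => f z • κ z) y u w - fderiv ℂ (fun z => f z • κ z) y w u -
        (fderiv ℂ f y u * κ y w - fderiv ℂ f y w * κ y u) := by
  rw [extDeriv_ofSubsingleton_apply hκ, fderiv_fun_smul hf hκ]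
  simp
  ring

/-- Currying replaces the alternating form by an operator-valued map, so that it can be evaluated on
vectors that vary with the point. -/
theorem contDiffAt_alternating_apply₂ [FiniteDimensional ℂ V] {b : V → V [⋀^Fin 2]→L[ℂ] ℂ} {y : V}
    (hb : AnalyticAt ℂ b y) :
    ∃ β : V → V →L[ℂ] V →L[ℂ] ℂ, ContDiffAt ℂ ω β y ∧ ∀ z u w, β z u w = b z ![u, w] := by
  let β : V → V →L[ℂ] V →L[ℂ] ℂ := fun z =>
    (((ContinuousAlternatingMap.ofSubsingletonLIE (𝕜 := ℂ) (E := V) (F := ℂ) (0 : Fin 1)).symm :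
      (V [⋀^Fin 1]→L[ℂ] ℂ) →L[ℂ] (V →L[ℂ] ℂ))).comp (b z).curryLeft
  have hβ : ∀ z u w, β z u w = b z ![u, w] := fun z u w => by
    change (b z).curryLeft u (fun _ => w) = _
    rw [ContinuousAlternatingMap.curryLeft_apply_apply]
    congr 1
    ext i
    fin_cases i <;> rfl
  refine ⟨β, ?_, hβ⟩
  rw [← contMDiffAt_iff_contDiffAt]
  refine contMDiffAt_clm_of_apply fun u => contMDiffAt_clm_of_apply fun w => ?_
  simp only [hβ]
  rw [contMDiffAt_iff_contDiffAt]
  exact (ContinuousAlternatingMap.apply ℂ V ℂ ![u, w]).contDiff.contDiffAt.comp y hb.contDiffAt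

end OneForms

/-! ### Forms, derivatives and holomorphy read in a chart -/

section Charts

variable {V : Type*} [NormedAddCommGroup V] [NormedSpace ℂ V]
  {X : Type*} [TopologicalSpace X] [ChartedSpace V X] [IsManifold 𝓘(ℂ, V) ω X]
  {Z : Type*} [NormedAddCommGroup Z] [NormedSpace ℂ Z]

variable (V) in
/-- The coordinate of a tangent vector at `z` in the chart at `x₀`. -/
abbrev toTan (x₀ z : X) : TangentSpace 𝓘(ℂ, V) z →L[ℂ] V :=
  toTriv V (TangentSpace 𝓘(ℂ, V) : X → Type _) x₀ z

variable (V) in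
/-- The tangent vector at `z` with given coordinates in the chart at `x₀`. -/
abbrev ofTan (x₀ z : X) : V →L[ℂ] TangentSpace 𝓘(ℂ, V) z :=
  ofTriv V (TangentSpace 𝓘(ℂ, V) : X → Type _) x₀ z

variable (V) in
/-- The domain of the chart at `x₀`. -/
abbrev chartOpen (x₀ : X) : Opens X := baseOpen V (TangentSpace 𝓘(ℂ, V) : X → Type _) x₀

theorem mem_chartOpen_iff {x₀ z : X} : z ∈ chartOpen V x₀ ↔ z ∈ (extChartAt 𝓘(ℂ, V) x₀).source := by
  rw [extChartAt_source]; rfl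

/-- The inverse of the tangent trivialization at x₀ is the derivative of the inverse chart, which is
the map used in the definition of `coordForm`. -/
theorem coordForm_apply (α : FormField (V := V) (Trivial X ℂ)) {x₀ z : X}
    (hz : z ∈ chartOpen V x₀) (w : V) :
    coordForm α x₀ (extChartAt 𝓘(ℂ, V) x₀ z) w = α z (ofTan V x₀ z w) := by
  have h1 : ofTan V x₀ z = mfderivWithin 𝓘(ℂ, V) 𝓘(ℂ, V) (extChartAt 𝓘(ℂ, V) x₀).symm
      (Set.range 𝓘(ℂ, V)) (extChartAt 𝓘(ℂ, V) x₀ z) := TangentBundle.symmL_trivializationAt hz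
  rw [h1, modelWithCornersSelf_coe, Set.range_id, mfderivWithin_univ]
  -- `coordForm` evaluates α at φ⁻¹(φ(z)), which is only propositionally equal to z. All tangent
  -- spaces are V by definition, so the two values can be compared as maps on V.
  have key : ∀ z', z' = z → (α z' : V →L[ℂ] ℂ) = α z := by rintro _ rfl; rfl
  have := key _ ((extChartAt 𝓘(ℂ, V) x₀).left_inv (mem_chartOpen_iff.1 hz))
  exact congrArg (fun L : V →L[ℂ] ℂ => L _) this

theorem form_apply_eq_coordForm (α : FormField (V := V) (Trivial X ℂ)) {x₀ z : X}
    (hz : z ∈ chartOpen V x₀) (v : TangentSpace 𝓘(ℂ, V) z) :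
    α z v = coordForm α x₀ (extChartAt 𝓘(ℂ, V) x₀ z) (toTan V x₀ z v) := by
  rw [coordForm_apply α hz, ofTriv_toTriv hz]

theorem mvfderiv_eq_fderiv_chart {f : X → Z} {x₀ z : X} (hz : z ∈ chartOpen V x₀)
    (hf : ContMDiffAt 𝓘(ℂ, V) 𝓘(ℂ, Z) ω f z) (v : TangentSpace 𝓘(ℂ, V) z) :
    mvfderiv 𝓘(ℂ, V) f z v =
      fderiv ℂ (f ∘ (extChartAt 𝓘(ℂ, V) x₀).symm) (extChartAt 𝓘(ℂ, V) x₀ z) (toTan V x₀ z v) := by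
  have hz' := mem_chartOpen_iff.1 hz
  have h1 : toTan V x₀ z = mfderiv 𝓘(ℂ, V) 𝓘(ℂ, V) (extChartAt 𝓘(ℂ, V) x₀) z :=
    TangentBundle.continuousLinearMapAt_trivializationAt hz
  have hzz : (extChartAt 𝓘(ℂ, V) x₀).symm (extChartAt 𝓘(ℂ, V) x₀ z) = z :=
    (extChartAt 𝓘(ℂ, V) x₀).left_inv hz'
  have hs : ContMDiffAt 𝓘(ℂ, V) 𝓘(ℂ, V) ω (extChartAt 𝓘(ℂ, V) x₀).symm
      (extChartAt 𝓘(ℂ, V) x₀ z) :=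
    (contMDiffOn_extChartAt_symm x₀).contMDiffAt
      ((isOpen_extChartAt_target x₀).mem_nhds ((extChartAt 𝓘(ℂ, V) x₀).map_source hz'))
  have hF : MDifferentiableAt 𝓘(ℂ, V) 𝓘(ℂ, Z) (f ∘ (extChartAt 𝓘(ℂ, V) x₀).symm)
      (extChartAt 𝓘(ℂ, V) x₀ z) :=
    (ContMDiffAt.comp _ (by rwa [hzz]) hs).mdifferentiableAt (by simp)
  have hφ : MDifferentiableAt 𝓘(ℂ, V) 𝓘(ℂ, V) (extChartAt 𝓘(ℂ, V) x₀) z :=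
    mdifferentiableAt_extChartAt hz
  have hfe : f =ᶠ[𝓝 z] (f ∘ (extChartAt 𝓘(ℂ, V) x₀).symm) ∘ (extChartAt 𝓘(ℂ, V) x₀) := by
    filter_upwards [baseOpen_mem_nhds hz] with y hy
    exact congrArg f ((extChartAt 𝓘(ℂ, V) x₀).left_inv (mem_chartOpen_iff.1 hy)).symm
  have h2 : mfderiv 𝓘(ℂ, V) 𝓘(ℂ, Z) f z v =
      mfderiv 𝓘(ℂ, V) 𝓘(ℂ, Z) (f ∘ (extChartAt 𝓘(ℂ, V) x₀).symm) (extChartAt 𝓘(ℂ, V) x₀ z)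
        (mfderiv 𝓘(ℂ, V) 𝓘(ℂ, V) (extChartAt 𝓘(ℂ, V) x₀) z v) := by
    rw [← mfderiv_comp_apply z hF hφ, hfe.mfderiv_eq]
    rfl
  rw [h1, ← mfderiv_eq_fderiv]
  exact h2

theorem contMDiffAt_comp_chart {a : V → Z} {x₀ z : X} (hz : z ∈ chartOpen V x₀)
    (ha : ContDiffAt ℂ ω a (extChartAt 𝓘(ℂ, V) x₀ z)) :
    ContMDiffAt 𝓘(ℂ, V) 𝓘(ℂ, Z) ω (fun y => a (extChartAt 𝓘(ℂ, V) x₀ y)) z :=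
  (contMDiffAt_iff_contDiffAt.2 ha).comp z (contMDiffAt_extChartAt' hz)

theorem contDiffAt_comp_chart_symm {f : X → Z} {x₀ z : X} (hz : z ∈ chartOpen V x₀)
    (hf : ContMDiffAt 𝓘(ℂ, V) 𝓘(ℂ, Z) ω f z) :
    ContDiffAt ℂ ω (f ∘ (extChartAt 𝓘(ℂ, V) x₀).symm) (extChartAt 𝓘(ℂ, V) x₀ z) := by
  have hz' := mem_chartOpen_iff.1 hz
  have hzz : (extChartAt 𝓘(ℂ, V) x₀).symm (extChartAt 𝓘(ℂ, V) x₀ z) = z :=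
    (extChartAt 𝓘(ℂ, V) x₀).left_inv hz'
  rw [← contMDiffAt_iff_contDiffAt]
  refine ContMDiffAt.comp _ (by rwa [hzz]) ?_
  exact (contMDiffOn_extChartAt_symm x₀).contMDiffAt
      ((isOpen_extChartAt_target x₀).mem_nhds ((extChartAt 𝓘(ℂ, V) x₀).map_source hz'))

theorem tendsto_chart {x₀ z : X} (hz : z ∈ chartOpen V x₀) :
    Filter.Tendsto (extChartAt 𝓘(ℂ, V) x₀) (𝓝 z) (𝓝 (extChartAt 𝓘(ℂ, V) x₀ z)) :=
  continuousAt_extChartAt' (mem_chartOpen_iff.1 hz)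

theorem tendsto_chart_symm {x₀ z : X} (hz : z ∈ chartOpen V x₀) :
    Filter.Tendsto (extChartAt 𝓘(ℂ, V) x₀).symm (𝓝 (extChartAt 𝓘(ℂ, V) x₀ z)) (𝓝 z) := by
  have h := continuousAt_extChartAt_symm' (I := 𝓘(ℂ, V)) (mem_chartOpen_iff.1 hz)
  rwa [ContinuousAt, (extChartAt 𝓘(ℂ, V) x₀).left_inv (mem_chartOpen_iff.1 hz)] at h

theorem eventually_chart_right_inv {x₀ z : X} (hz : z ∈ chartOpen V x₀) :
    ∀ᶠ y in 𝓝 (extChartAt 𝓘(ℂ, V) x₀ z),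
      extChartAt 𝓘(ℂ, V) x₀ ((extChartAt 𝓘(ℂ, V) x₀).symm y) = y := by
  filter_upwards [(isOpen_extChartAt_target (I := 𝓘(ℂ, V)) x₀).mem_nhds
    ((extChartAt 𝓘(ℂ, V) x₀).map_source (mem_chartOpen_iff.1 hz))] with y hy
  exact (extChartAt 𝓘(ℂ, V) x₀).right_inv hy

end Charts

end LogAtiyah

end

noncomputable section

namespace LogAtiyah

section LogFields

variable {V : Type*} [NormedAddCommGroup V] [NormedSpace ℂ V]
  {X : Type*} [TopologicalSpace X] [ChartedSpace V X] [IsManifold 𝓘(ℂ, V) ω X]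
  {D : ReducedDivisor V X}

/-! ### Logarithmic vector fields -/

theorem mem_TLog_iff {U : Opens X} {v : Π x : X, TangentSpace 𝓘(ℂ, V) x} :
    v ∈ TLog D U ↔ v ∈ Sec 𝓘(ℂ, V) V (TangentSpace 𝓘(ℂ, V) : X → Type _) U ∧
      ∀ W ≤ U, ∀ α : FormField (V := V) (Trivial X ℂ), IsLogForm D W α →
        ∀ x ∈ W, ExtendsAt D (fun z => (α z (v z) : ℂ)) x := by
  refine and_congr Iff.rfl (forall₄_congr fun W _ α _ => ?_)
  exact exists_contMDiffOn_iff_extendsAt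

theorem contMDiffAt_form_apply {U : Opens X} {α : FormField (V := V) (Trivial X ℂ)}
    (hα : α ∈ Sec 𝓘(ℂ, V) (V →L[ℂ] ℂ)
      (fun x => TangentSpace 𝓘(ℂ, V) x →L[ℂ] Trivial X ℂ x) U) {x : X} (hx : x ∈ U)
    {v : Π x : X, TangentSpace 𝓘(ℂ, V) x}
    (hv : ContMDiffAt 𝓘(ℂ, V) (𝓘(ℂ, V).prod 𝓘(ℂ, V)) ω (fun z => TotalSpace.mk' V z (v z)) x) :
    ContMDiffAt 𝓘(ℂ, V) 𝓘(ℂ) ω (fun z => (α z (v z) : ℂ)) x := by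
  have h := ContMDiffAt.clm_bundle_apply (Sec.contMDiffAt hα hx) hv
  have h2 := (contMDiffAt_section_iff_toTriv (mem_baseOpen_self ℂ x)).1 h
  simpa using h2

/-- Off D logarithmic forms are holomorphic, so they pair holomorphically with any holomorphic
field. -/
theorem mem_TLog_of_disjoint {U : Opens X} (hU : ∀ x ∈ U, x ∉ D.supp)
    {v : Π x : X, TangentSpace 𝓘(ℂ, V) x}
    (hv : v ∈ Sec 𝓘(ℂ, V) V (TangentSpace 𝓘(ℂ, V) : X → Type _) U) : v ∈ TLog D U := by
  refine mem_TLog_iff.2 ⟨hv, fun W hW α hα x hx => ?_⟩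
  exact (contMDiffAt_form_apply hα.holo (D.mem_away.2 ⟨hx, hU x (hW hx)⟩)
    (Sec.contMDiffAt hv (hW hx))).extendsAt

theorem IsLocalEquation.mono {S : Set X} {W W' : Opens X} {f : X → ℂ}
    (hf : IsLocalEquation (V := V) S W f) (h : W' ≤ W) : IsLocalEquation (V := V) S W' f :=
  ⟨hf.holo.mono h, fun x hx => hf.zero_iff x (h hx), fun W'' hW'' => hf.generates W'' (hW''.trans h)⟩

theorem IsLocalEquation.contMDiffAt {S : Set X} {W : Opens X} {f : X → ℂ}
    (hf : IsLocalEquation (V := V) S W f) {x : X} (hx : x ∈ W) :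
    ContMDiffAt 𝓘(ℂ, V) 𝓘(ℂ) ω f x := hf.holo.contMDiffAt (W.2.mem_nhds hx)

/-- α(fu) = (fα)(u), and fα is holomorphic because the pole of α is simple. -/
theorem smul_mem_TLog {W : Opens X} {f : X → ℂ} (hf : IsLocalEquation (V := V) D.supp W f)
    {u : Π x : X, TangentSpace 𝓘(ℂ, V) x}
    (hu : u ∈ Sec 𝓘(ℂ, V) V (TangentSpace 𝓘(ℂ, V) : X → Type _) W) :
    (fun x => f x • u x) ∈ TLog D W := by
  refine mem_TLog_iff.2 ⟨Sec.smul_mem hf.holo hu, fun W' hW' α hα x hx => ?_⟩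
  obtain ⟨a, _, ha, _, hab⟩ := hα.pole W' le_rfl f (hf.mono hW') x hx
  have hxc := mem_baseOpen_self V (E := (TangentSpace 𝓘(ℂ, V) : X → Type _)) x
  refine ⟨fun z => a (extChartAt 𝓘(ℂ, V) x z) (toTan V x z (u z)),
    (contMDiffAt_comp_chart hxc ha.contDiffAt).clm_apply
      (Sec.contMDiffAt_toTriv hu (hW' hx) hxc), ?_⟩
  filter_upwards [hab, baseOpen_mem_nhds hxc] with z hz hzc hzD
  rw [← (hz hzD).1, map_smul, form_apply_eq_coordForm α hzc]
  rfl

/-- The identity `f dα = d(f α) - df ∧ α` in coordinates. -/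
theorem eventually_smul_coordExtDeriv {W : Opens X} {f : X → ℂ}
    (hf : IsLocalEquation (V := V) D.supp W f) {α : FormField (V := V) (Trivial X ℂ)} {x : X}
    (hx : x ∈ W) {a : V → V →L[ℂ] ℂ} (ha : ContDiffAt ℂ ω a (extChartAt 𝓘(ℂ, V) x x))
    (hfa : ∀ᶠ z in 𝓝 x, z ∉ D.supp →
      f z • coordForm α x (extChartAt 𝓘(ℂ, V) x z) = a (extChartAt 𝓘(ℂ, V) x z)) :
    ∀ᶠ z in 𝓝 x, z ∉ D.supp → ∀ u w : V,
      f z * coordExtDeriv α x (extChartAt 𝓘(ℂ, V) x z) ![u, w] =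
        fderiv ℂ a (extChartAt 𝓘(ℂ, V) x z) u w - fderiv ℂ a (extChartAt 𝓘(ℂ, V) x z) w u -
        (mvfderiv 𝓘(ℂ, V) f z (ofTan V x z u) * α z (ofTan V x z w) -
          mvfderiv 𝓘(ℂ, V) f z (ofTan V x z w) * α z (ofTan V x z u)) := by
  have hxc := mem_baseOpen_self V (E := (TangentSpace 𝓘(ℂ, V) : X → Type _)) x
  filter_upwards [eventually_eventually_nhds.2 hfa, baseOpen_mem_nhds hxc, W.2.mem_nhds hx,
    (tendsto_chart hxc).eventually (ha.eventually (by simp))] with z h1 hzc hzW haz hzD u w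
  set φ := extChartAt 𝓘(ℂ, V) x with hφ
  have hzz : φ.symm (φ z) = z := φ.left_inv (mem_chartOpen_iff.1 hzc)
  have hF : DifferentiableAt ℂ (f ∘ φ.symm) (φ z) :=
    (contDiffAt_comp_chart_symm hzc (hf.contMDiffAt hzW)).differentiableAt (by simp)
  have hev : ∀ᶠ y in 𝓝 (φ z), f (φ.symm y) • coordForm α x y = a y ∧ f (φ.symm y) ≠ 0 := by
    filter_upwards [(tendsto_chart_symm hzc).eventually h1,
      (tendsto_chart_symm hzc).eventually (D.eventually_notMem hzD),
      (tendsto_chart_symm hzc).eventually (W.2.mem_nhds hzW),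
      eventually_chart_right_inv hzc] with y hy1 hy2 hy3 hy4
    refine ⟨?_, fun h0 => hy2 ((hf.zero_iff _ hy3).1 h0)⟩
    have := hy1 hy2
    rwa [← hφ, hy4] at this
  -- Off D the form is a/f with f ≠ 0, so differentiability comes from the simple-pole hypothesis
  -- alone; holomorphy of α is not assumed here.
  have hκ : DifferentiableAt ℂ (coordForm α x) (φ z) := by
    have h2 : DifferentiableAt ℂ (fun y => (f (φ.symm y))⁻¹ • a y) (φ z) :=
      (hF.inv hev.self_of_nhds.2).smul (haz.differentiableAt (by simp))
    refine h2.congr_of_eventuallyEq ?_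
    filter_upwards [hev] with y hy
    rw [← hy.1, smul_smul, inv_mul_cancel₀ hy.2, one_smul]
  have h3 := smul_extDeriv_apply hκ hF u w
  have h4 : (fun y => (f ∘ φ.symm) y • coordForm α x y) =ᶠ[𝓝 (φ z)] a := by
    filter_upwards [hev] with y hy
    exact hy.1
  rw [h4.fderiv_eq, Function.comp_apply, hzz] at h3
  rw [mvfderiv_eq_fderiv_chart hzc (hf.contMDiffAt hzW),
    mvfderiv_eq_fderiv_chart hzc (hf.contMDiffAt hzW), toTriv_ofTriv hzc, toTriv_ofTriv hzc,
    ← coordForm_apply α hzc, ← coordForm_apply α hzc]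
  exact h3

/-- The field `df(u) w - df(w) u`, which annihilates the local equation `f` of `D`, is
logarithmic. -/
theorem deriv_smul_sub_mem_TLog [FiniteDimensional ℂ V] {W : Opens X} {f : X → ℂ}
    (hf : IsLocalEquation (V := V) D.supp W f)
    {u w : Π x : X, TangentSpace 𝓘(ℂ, V) x}
    (hu : u ∈ Sec 𝓘(ℂ, V) V (TangentSpace 𝓘(ℂ, V) : X → Type _) W)
    (hw : w ∈ Sec 𝓘(ℂ, V) V (TangentSpace 𝓘(ℂ, V) : X → Type _) W) :
    (fun x => mvfderiv 𝓘(ℂ, V) f x (u x) • w x - mvfderiv 𝓘(ℂ, V) f x (w x) • u x) ∈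
      TLog D W := by
  have hd : ∀ v ∈ Sec 𝓘(ℂ, V) V (TangentSpace 𝓘(ℂ, V) : X → Type _) W,
      ContMDiffOn 𝓘(ℂ, V) 𝓘(ℂ) ω (fun x => mvfderiv 𝓘(ℂ, V) f x (v x)) W := fun v hv x hx =>
    (contMDiffAt_mvfderiv_apply (hf.contMDiffAt hx)
      (Sec.contMDiffAt hv hx)).contMDiffWithinAt
  refine mem_TLog_iff.2 ⟨sub_mem (Sec.smul_mem (hd u hu) hw) (Sec.smul_mem (hd w hw) hu),
    fun W' hW' α hα x hx => ?_⟩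
  obtain ⟨a, b, ha, hb, hab⟩ := hα.pole W' le_rfl f (hf.mono hW') x hx
  obtain ⟨β, hβ, hβb⟩ := contDiffAt_alternating_apply₂ hb
  have hxc := mem_baseOpen_self V (E := (TangentSpace 𝓘(ℂ, V) : X → Type _)) x
  have hus := Sec.contMDiffAt_toTriv hu (hW' hx) hxc
  have hws := Sec.contMDiffAt_toTriv hw (hW' hx) hxc
  have hda := contMDiffAt_comp_chart hxc ((ha.contDiffAt (n := ω)).fderiv_right (m := ω) (by simp))
  -- This is d(fα)(u, w) − f dα(u, w), with a and β the holomorphic extensions of fα and f dα. Off D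
  -- it equals (df ∧ α)(u, w), the value of α on the field.
  refine ⟨fun z => fderiv ℂ a (extChartAt 𝓘(ℂ, V) x z) (toTan V x z (u z)) (toTan V x z (w z)) -
    fderiv ℂ a (extChartAt 𝓘(ℂ, V) x z) (toTan V x z (w z)) (toTan V x z (u z)) -
    β (extChartAt 𝓘(ℂ, V) x z) (toTan V x z (u z)) (toTan V x z (w z)),
    (((hda.clm_apply hus).clm_apply hws).sub ((hda.clm_apply hws).clm_apply hus)).sub
      (((contMDiffAt_comp_chart hxc hβ).clm_apply hus).clm_apply hws), ?_⟩
  filter_upwards [hab, eventually_smul_coordExtDeriv (hf.mono hW') hx ha.contDiffAt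
    (hab.mono fun z hz hzD => (hz hzD).1), baseOpen_mem_nhds hxc] with z hz hz' hzc hzD
  have h := hz' hzD (toTan V x z (u z)) (toTan V x z (w z))
  rw [ofTriv_toTriv hzc, ofTriv_toTriv hzc] at h
  have h2 := congrArg (fun c => c ![toTan V x z (u z), toTan V x z (w z)]) (hz hzD).2
  rw [hβb, ← h2, map_sub, map_smul, map_smul]
  refine (congrArg _ h).trans ?_
  simp only [smul_eq_mul]
  ring

/-! ### Reflexivity of the sheaf of logarithmic forms -/

/-- Values on fixed pairs control the curried bilinear map, and alternatizing that map returns the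
form up to a factor. -/
theorem ExtendsAt.alternating_of_apply [FiniteDimensional ℂ V] {b : X → V [⋀^Fin 2]→L[ℂ] ℂ} {x : X}
    (h : ∀ u w, ExtendsAt D (fun z => b z ![u, w]) x) : ExtendsAt D b x := by
  let L := ContinuousAlternatingMap.ofSubsingletonLIE (𝕜 := ℂ) (E := V) (F := ℂ) (0 : Fin 1)
  have hB : ∀ u, ExtendsAt D (fun z => L.symm ((b z).curryLeft u)) x := fun u => by
    refine ExtendsAt.clm_of_apply fun w => (h u w).congr (Filter.Eventually.of_forall fun z _ => ?_)
    change _ = (b z).curryLeft u (fun _ => w)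
    rw [ContinuousAlternatingMap.curryLeft_apply_apply]
    congr 1
    ext i
    fin_cases i <;> rfl
  have hg : ExtendsAt D (fun z => (b z).curryLeft) x := by
    refine ExtendsAt.clm_of_apply fun u => ?_
    simpa using (hB u).clm_comp (L : (V →L[ℂ] ℂ) →L[ℂ] (V [⋀^Fin 1]→L[ℂ] ℂ))
  -- Alternatizing the curried form of degree 2 yields twice the form, hence the factor 1/2.
  have h2 := hg.clm_comp ((2⁻¹ : ℂ) • ContinuousAlternatingMap.alternatizeUncurryFinCLM ℂ V ℂ)
  refine h2.congr (Filter.Eventually.of_forall fun z _ => ?_)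
  have := ContinuousAlternatingMap.alternatizeUncurryFin_curryLeft (b z)
  change (2⁻¹ : ℂ) • ContinuousAlternatingMap.alternatizeUncurryFin (b z).curryLeft = b z
  rw [this, ← Nat.cast_smul_eq_nsmul ℂ, smul_smul]
  norm_num

/-- The sheaf of logarithmic forms is reflexive: a form whose values on logarithmic vector fields
extend holomorphically across `D` is logarithmic. -/
theorem isLogForm_of_extendsAt [FiniteDimensional ℂ V] {U : Opens X}
    {α : FormField (V := V) (Trivial X ℂ)} (h0 : ∀ x ∉ D.away U, α x = 0)
    (h : ∀ W ≤ U, ∀ v ∈ TLog D W, ∀ x ∈ W, ExtendsAt D (fun z => (α z (v z) : ℂ)) x) :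
    IsLogForm D U α := by
  have hcoord : ∀ (x : X) (w : V) (W : Opens X), W ≤ chartOpen V x →
      restrictTo W (fun z => ofTan V x z w) ∈
        Sec 𝓘(ℂ, V) V (TangentSpace 𝓘(ℂ, V) : X → Type _) W := fun x w W hW =>
    restrictTo_mem_sec fun y hy => contMDiffAt_ofTriv (hW hy) contMDiffAt_const
  refine ⟨⟨fun x hx => (contMDiffAt_hom_of_apply fun w => ?_).contMDiffWithinAt, h0⟩,
    fun W hW f hf x hx => ?_⟩
  · have hxc := mem_baseOpen_self V (E := (TangentSpace 𝓘(ℂ, V) : X → Type _)) x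
    -- Off D every holomorphic field is logarithmic, so the fields that are constant in the chart
    -- are available to test holomorphy of α.
    have hv : restrictTo (D.away U ⊓ chartOpen V x) (fun z => ofTan V x z w) ∈
        TLog D (D.away U ⊓ chartOpen V x) :=
      mem_TLog_of_disjoint (fun y (hy : y ∈ D.away U ⊓ chartOpen V x) => hy.1.2) (hcoord x w _ inf_le_right)
    have h1 := (h _ (inf_le_left.trans D.away_le) _ hv x ⟨hx, hxc⟩).contMDiffAt hx.2
    refine h1.congr_of_eventuallyEq ?_
    filter_upwards [(D.away U ⊓ chartOpen V x).2.mem_nhds ⟨hx, hxc⟩] with z hz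
    rw [restrictTo_of_mem _ hz, toTriv_trivial]
    rfl
  · have hxc := mem_baseOpen_self V (E := (TangentSpace 𝓘(ℂ, V) : X → Type _)) x
    set W' : Opens X := W ⊓ chartOpen V x with hW'
    have hxW' : x ∈ W' := ⟨hx, hxc⟩
    have hf' : IsLocalEquation (V := V) D.supp W' f := hf.mono inf_le_left
    set c : V → Π z : X, TangentSpace 𝓘(ℂ, V) z :=
      fun w => restrictTo W' (fun z => ofTan V x z w) with hc
    have hcS := fun w => hcoord x w W' inf_le_right
    have hW'U : W' ≤ U := inf_le_left.trans hW
    have hcz : ∀ z ∈ W', ∀ w, c w z = ofTan V x z w := fun z hz w => restrictTo_of_mem _ hz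
    have hnear : ∀ᶠ z in 𝓝 x, z ∈ W' := W'.2.mem_nhds hxW'
    -- The first pole condition: pair α with f times the coordinate fields.
    have hA : ExtendsAt D (fun z => f z • coordForm α x (extChartAt 𝓘(ℂ, V) x z)) x := by
      refine ExtendsAt.clm_of_apply fun w =>
        (h W' hW'U _ (smul_mem_TLog hf' (hcS w)) x hxW').congr ?_
      filter_upwards [hnear] with z hz hzD
      rw [map_smul, restrictTo_of_mem _ hz, smul_apply,
        coordForm_apply α hz.2]
    obtain ⟨a', ha', haf⟩ := hA
    set a : V → V →L[ℂ] ℂ := a' ∘ (extChartAt 𝓘(ℂ, V) x).symm with ha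
    have haC : ContDiffAt ℂ ω a (extChartAt 𝓘(ℂ, V) x x) := contDiffAt_comp_chart_symm hxc ha'
    have haf' : ∀ᶠ z in 𝓝 x, z ∉ D.supp →
        f z • coordForm α x (extChartAt 𝓘(ℂ, V) x z) = a (extChartAt 𝓘(ℂ, V) x z) := by
      filter_upwards [haf, hnear] with z hz hzW hzD
      rw [← hz hzD]
      exact congrArg a' ((extChartAt 𝓘(ℂ, V) x).left_inv (mem_chartOpen_iff.1 hzW.2)).symm
    have hda := contMDiffAt_comp_chart hxc (haC.fderiv_right (m := ω) (by simp))
    have hB : ExtendsAt D (fun z => f z • coordExtDeriv α x (extChartAt 𝓘(ℂ, V) x z)) x := by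
      refine ExtendsAt.alternating_of_apply fun u w => ?_
      have h1 := (((hda.clm_apply (contMDiffAt_const (c := u))).clm_apply
        (contMDiffAt_const (c := w))).sub ((hda.clm_apply (contMDiffAt_const (c := w))).clm_apply
        (contMDiffAt_const (c := u)))).extendsAt (D := D)
      -- The arguments are swapped so that this contributes −(df ∧ α)(u, w); adding d(fα)(u, w)
      -- gives f dα(u, w).
      have h2 := (h W' hW'U _ (deriv_smul_sub_mem_TLog hf' (hcS w) (hcS u)) x hxW')
      refine (h1.add h2).congr ?_
      filter_upwards [eventually_smul_coordExtDeriv hf' hxW' haC haf', hnear] with z hz hzW hzD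
      rw [ContinuousAlternatingMap.smul_apply, smul_eq_mul, hz hzD u w, map_sub, map_smul, map_smul,
        restrictTo_of_mem _ hzW, restrictTo_of_mem _ hzW]
      simp only [smul_eq_mul]
      ring
    obtain ⟨b', hb', hbf⟩ := hB
    refine ⟨a, b' ∘ (extChartAt 𝓘(ℂ, V) x).symm, haC.analyticAt,
      (contDiffAt_comp_chart_symm hxc hb').analyticAt, ?_⟩
    filter_upwards [haf', hbf, hnear] with z hz hz' hzW hzD
    refine ⟨hz hzD, ?_⟩
    rw [← hz' hzD]
    exact congrArg b' ((extChartAt 𝓘(ℂ, V) x).left_inv (mem_chartOpen_iff.1 hzW.2)).symm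

end LogFields

end LogAtiyah

end

noncomputable section

namespace LogAtiyah

/-! ### Product rules for derivatives of operator-valued functions -/

section ProductRule

variable {B : Type*} [NormedAddCommGroup B] [NormedSpace ℂ B] {H : Type*} [TopologicalSpace H]
  {J : ModelWithCorners ℂ B H} {M : Type*} [TopologicalSpace M] [ChartedSpace H M]
  {Y Z Z' : Type*} [NormedAddCommGroup Y] [NormedSpace ℂ Y] [NormedAddCommGroup Z] [NormedSpace ℂ Z]
  [NormedAddCommGroup Z'] [NormedSpace ℂ Z']

theorem mvfderiv_clm_apply {f : M → Z →L[ℂ] Z'} {g : M → Z} {x : M}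
    (hf : ContMDiffAt J 𝓘(ℂ, Z →L[ℂ] Z') ω f x) (hg : ContMDiffAt J 𝓘(ℂ, Z) ω g x)
    (v : TangentSpace J x) :
    mvfderiv J (fun y => f y (g y)) x v = mvfderiv J f x v (g x) + f x (mvfderiv J g x v) := by
  have hf' := hf.mdifferentiableAt (n := ω) (by simp)
  have hg' := hg.mdifferentiableAt (n := ω) (by simp)
  have hfg := (hf.clm_apply hg).mdifferentiableAt (n := ω) (by simp)
  have h1 : DifferentiableWithinAt ℂ (writtenInExtChartAt J 𝓘(ℂ, Z →L[ℂ] Z') x f) (Set.range J)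
      (extChartAt J x x) := hf'.differentiableWithinAt_writtenInExtChartAt
  have h2 : DifferentiableWithinAt ℂ (writtenInExtChartAt J 𝓘(ℂ, Z) x g) (Set.range J)
      (extChartAt J x x) := hg'.differentiableWithinAt_writtenInExtChartAt
  rw [hf'.mvfderiv, hg'.mvfderiv, hfg.mvfderiv]
  have h3 := fderivWithin_clm_apply (J.uniqueDiffWithinAt_image (x := chartAt H x x)) h1 h2
  have h4 : writtenInExtChartAt J 𝓘(ℂ, Z →L[ℂ] Z') x f (extChartAt J x x) = f x := by
    simp only [writtenInExtChartAt, Function.comp_apply, extChartAt_to_inv]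
    rfl
  have h5 : writtenInExtChartAt J 𝓘(ℂ, Z) x g (extChartAt J x x) = g x := by
    simp only [writtenInExtChartAt, Function.comp_apply, extChartAt_to_inv]
    rfl
  refine (congrArg (fun L : B →L[ℂ] Z' => L v) h3).trans ?_
  rw [← h4, ← h5]
  exact add_comm _ _

theorem mvfderiv_apply_const {f : M → Z →L[ℂ] Z'} {x : M}
    (hf : ContMDiffAt J 𝓘(ℂ, Z →L[ℂ] Z') ω f x) (v : TangentSpace J x) (w : Z) :
    mvfderiv J (fun y => f y w) x v = mvfderiv J f x v w := by
  rw [mvfderiv_clm_apply hf contMDiffAt_const, mvfderiv_const]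
  simp

theorem mvfderiv_const_apply (L : Z →L[ℂ] Z') {g : M → Z} {x : M}
    (hg : ContMDiffAt J 𝓘(ℂ, Z) ω g x) (v : TangentSpace J x) :
    mvfderiv J (fun y => L (g y)) x v = L (mvfderiv J g x v) := by
  rw [mvfderiv_clm_apply contMDiffAt_const hg, mvfderiv_const]
  simp

theorem mvfderiv_clm_comp {f : M → Z →L[ℂ] Z'} {g : M → Y →L[ℂ] Z} {x : M}
    (hf : ContMDiffAt J 𝓘(ℂ, Z →L[ℂ] Z') ω f x) (hg : ContMDiffAt J 𝓘(ℂ, Y →L[ℂ] Z) ω g x)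
    (v : TangentSpace J x) :
    mvfderiv J (fun y => (f y).comp (g y)) x v =
      (mvfderiv J f x v).comp (g x) + (f x).comp (mvfderiv J g x v) := by
  ext w
  rw [← mvfderiv_apply_const (hf.clm_comp hg)]
  simp only [ContinuousLinearMap.comp_apply]
  rw [mvfderiv_clm_apply hf (hg.clm_apply contMDiffAt_const), mvfderiv_apply_const hg]
  rfl

theorem mvfderiv_congr {f g : M → Z} {x : M} (h : f =ᶠ[𝓝 x] g) (v : TangentSpace J x) :
    mvfderiv J f x v = mvfderiv J g x v :=
  congrArg (fun L : B →L[ℂ] Z => L v) h.mfderiv_eq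

end ProductRule

/-! ### Connection forms and the covariant derivative they define -/

section

variable {V : Type*} [NormedAddCommGroup V] [NormedSpace ℂ V]
  {X : Type*} [TopologicalSpace X] [ChartedSpace V X] [IsManifold 𝓘(ℂ, V) ω X]
  {D : ReducedDivisor V X}

theorem IsLogForm.restrict {U W : Opens X} (hWU : W ≤ U) {α : FormField (V := V) (Trivial X ℂ)}
    (hα : IsLogForm D U α) : IsLogForm D W (restrictTo (D.away W) α) := by
  refine ⟨Sec.restrict_mem (D.away_mono hWU) hα.holo, fun W' hW' f hf x hx => ?_⟩
  obtain ⟨a, b, ha, hb, hab⟩ := hα.pole W' (hW'.trans hWU) f hf x hx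
  refine ⟨a, b, ha, hb, ?_⟩
  have hxc := mem_baseOpen_self V (E := (TangentSpace 𝓘(ℂ, V) : X → Type _)) x
  filter_upwards [hab, baseOpen_mem_nhds hxc, W'.2.mem_nhds hx] with z hz hzc hzW hzD
  have hev : ∀ᶠ y in 𝓝 (extChartAt 𝓘(ℂ, V) x z),
      coordForm (restrictTo (D.away W) α) x y = coordForm α x y := by
    filter_upwards [(tendsto_chart_symm hzc).eventually (D.eventually_notMem hzD),
      (tendsto_chart_symm hzc).eventually (W'.2.mem_nhds hzW)] with y hy1 hy2
    have hy : (extChartAt 𝓘(ℂ, V) x).symm y ∈ D.away W := ⟨hW' hy2, hy1⟩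
    rw [coordForm, restrictTo_of_mem _ hy, coordForm]
  have hev' : coordExtDeriv (restrictTo (D.away W) α) x (extChartAt 𝓘(ℂ, V) x z) =
      coordExtDeriv α x (extChartAt 𝓘(ℂ, V) x z) :=
    Filter.EventuallyEq.extDeriv_eq (hev.mono fun y hy => by simp only [hy])
  rw [hev.self_of_nhds, hev']
  exact hz hzD

/-- The pairing is local, so restricting both arguments to U ∩ W removes the requirement that the
form live on a subset of the domain of the field. -/
theorem TLog.extendsAt {U W : Opens X} {v : Π x : X, TangentSpace 𝓘(ℂ, V) x} (hv : v ∈ TLog D U)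
    {α : FormField (V := V) (Trivial X ℂ)} (hα : IsLogForm D W α) {x : X} (hxU : x ∈ U)
    (hxW : x ∈ W) : ExtendsAt D (fun z => (α z (v z) : ℂ)) x := by
  refine ((mem_TLog_iff.1 hv).2 (U ⊓ W) inf_le_left _ (hα.restrict inf_le_right) x
    ⟨hxU, hxW⟩).congr ?_
  filter_upwards [(U ⊓ W).2.mem_nhds ⟨hxU, hxW⟩] with z hz hzD
  have hz' : z ∈ D.away (U ⊓ W) := ⟨hz, hzD⟩
  rw [restrictTo_of_mem _ hz']

variable (F : Type*) [NormedAddCommGroup F] [NormedSpace ℂ F]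
  (E : X → Type*) [TopologicalSpace (TotalSpace F E)]
  [∀ x, AddCommGroup (E x)] [∀ x, Module ℂ (E x)] [∀ x, TopologicalSpace (E x)]
  [FiberBundle F E] [VectorBundle ℂ F E]

variable (D) in
/-- The connection forms of a logarithmic connection in the preferred trivializations of `E`:
matrix-valued forms outside `D`, transforming by the gauge transformation rule, whose values on
logarithmic vector fields extend holomorphically across `D`. -/
structure ConnectionForms where
  /-- The connection form in the trivialization at `x₀`. -/
  form : X → ∀ y : X, TangentSpace 𝓘(ℂ, V) y →L[ℂ] (F →L[ℂ] F)
  extendsAt_form : ∀ (x₀ : X) (U : Opens X), U ≤ baseOpen F E x₀ → ∀ v ∈ TLog D U, ∀ x ∈ U,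
    ExtendsAt D (fun y => form x₀ y (v y)) x
  gauge : ∀ x₀ x₁ y, y ∈ baseOpen F E x₀ → y ∈ baseOpen F E x₁ → y ∉ D.supp →
    ∀ v : TangentSpace 𝓘(ℂ, V) y,
      mvfderiv 𝓘(ℂ, V) (transition F E x₀ x₁) y v + (form x₁ y v).comp (transition F E x₀ x₁ y) =
        (transition F E x₀ x₁ y).comp (form x₀ y v)

variable {F E}

theorem ConnectionForms.extendsAt (c : ConnectionForms D F E) {U : Opens X}
    {v : Π x : X, TangentSpace 𝓘(ℂ, V) x} (hv : v ∈ TLog D U) {x₀ x : X} (hx : x ∈ U)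
    (hx₀ : x ∈ baseOpen F E x₀) : ExtendsAt D (fun y => c.form x₀ y (v y)) x := by
  have hm : x ∈ U ⊓ baseOpen F E x₀ := ⟨hx, hx₀⟩
  refine (c.extendsAt_form x₀ (U ⊓ baseOpen F E x₀) inf_le_right _
    (TLog.restrict_mem inf_le_left hv) x hm).congr ?_
  filter_upwards [(U ⊓ baseOpen F E x₀).2.mem_nhds hm] with z hz hzD
  have hz' : z ∈ U ⊓ baseOpen F E x₀ := hz
  rw [restrictTo_of_mem _ hz']

theorem constField_mem_TLog {x : X} {W : Opens X} (hW : W ≤ chartOpen V x)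
    (hWD : ∀ y ∈ W, y ∉ D.supp) (w : V) :
    restrictTo W (fun z => ofTan V x z w) ∈ TLog D W :=
  mem_TLog_of_disjoint hWD
    (restrictTo_mem_sec fun _ hy => contMDiffAt_ofTriv (hW hy) contMDiffAt_const)

/-! ### From connection forms to a logarithmic connection -/

/-- The covariant derivative with given connection forms, at a point. -/
def ConnectionForms.covDeriv (c : ConnectionForms D F E) (s : Π x, E x) (y : X) :
    TangentSpace 𝓘(ℂ, V) y →L[ℂ] E y :=
  (ofTriv F E y y).comp (mvfderiv 𝓘(ℂ, V) (fun z => toTriv F E y z (s z)) y +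
    (ContinuousLinearMap.apply ℂ F (toTriv F E y y (s y))).comp (c.form y y))

theorem ConnectionForms.covDeriv_apply (c : ConnectionForms D F E) (s : Π x, E x) (y : X)
    (v : TangentSpace 𝓘(ℂ, V) y) :
    c.covDeriv s y v = ofTriv F E y y (mvfderiv 𝓘(ℂ, V) (fun z => toTriv F E y z (s z)) y v +
      c.form y y v (toTriv F E y y (s y))) := rfl

variable [ContMDiffVectorBundle ω F E 𝓘(ℂ, V)]

/-- `covDeriv` uses at y the trivialization centred at y, a choice that jumps with y. The gauge rule
turns it into d + A in any fixed trivialization, which is what makes holomorphy visible. -/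
theorem ConnectionForms.toTriv_covDeriv (c : ConnectionForms D F E) {U : Opens X} {s : Π x, E x}
    (hs : s ∈ Sec 𝓘(ℂ, V) F E U) {x₀ y : X} (hy : y ∈ U) (hyD : y ∉ D.supp)
    (hy₀ : y ∈ baseOpen F E x₀) (v : TangentSpace 𝓘(ℂ, V) y) :
    toTriv F E x₀ y (c.covDeriv s y v) =
      mvfderiv 𝓘(ℂ, V) (fun z => toTriv F E x₀ z (s z)) y v +
        c.form x₀ y v (toTriv F E x₀ y (s y)) := by
  have hyy := mem_baseOpen_self F (E := E) y
  have h1 : (fun z => toTriv F E x₀ z (s z)) =ᶠ[𝓝 y]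
      fun z => transition F E y x₀ z (toTriv F E y z (s z)) := by
    filter_upwards [baseOpen_mem_nhds hyy] with z hz
    rw [transition_toTriv hz]
  rw [mvfderiv_congr h1, mvfderiv_clm_apply (contMDiffAt_transition hyy hy₀)
    (Sec.contMDiffAt_toTriv hs hy hyy), ← transition_toTriv hyy (x₁ := x₀) (s y)]
  have h2 := congrArg (fun L : F →L[ℂ] F => L (toTriv F E y y (s y)))
    (c.gauge y x₀ y hyy hy₀ hyD v)
  simp only [add_apply, ContinuousLinearMap.comp_apply] at h2
  rw [c.covDeriv_apply, add_right_comm, h2, ← map_add, add_comm]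
  rfl

theorem ConnectionForms.covDeriv_congr (c : ConnectionForms D F E) {s t : Π x, E x} {y : X}
    (h : ∀ᶠ z in 𝓝 y, s z = t z) : c.covDeriv s y = c.covDeriv t y := by
  ext v
  rw [c.covDeriv_apply, c.covDeriv_apply, h.self_of_nhds,
    mvfderiv_congr (g := fun z => toTriv F E y z (t z)) (h.mono fun z hz => by simp only [hz])]

theorem ConnectionForms.covDeriv_add (c : ConnectionForms D F E) {U : Opens X} {s t : Π x, E x}
    (hs : s ∈ Sec 𝓘(ℂ, V) F E U) (ht : t ∈ Sec 𝓘(ℂ, V) F E U) {y : X} (hy : y ∈ U)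
    (v : TangentSpace 𝓘(ℂ, V) y) :
    c.covDeriv (s + t) y v = c.covDeriv s y v + c.covDeriv t y v := by
  have hyy := mem_baseOpen_self F (E := E) y
  have h1 := (Sec.contMDiffAt_toTriv hs hy hyy).mdifferentiableAt (by simp)
  have h2 := (Sec.contMDiffAt_toTriv ht hy hyy).mdifferentiableAt (by simp)
  rw [c.covDeriv_apply, c.covDeriv_apply, c.covDeriv_apply]
  simp only [Pi.add_apply, map_add]
  rw [mvfderiv_fun_add h1 h2, add_apply, map_add]
  abel

theorem ConnectionForms.covDeriv_smul (c : ConnectionForms D F E) {U : Opens X} {s : Π x, E x}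
    (hs : s ∈ Sec 𝓘(ℂ, V) F E U) {f : X → ℂ} {y : X} (hf : ContMDiffAt 𝓘(ℂ, V) 𝓘(ℂ) ω f y)
    (hy : y ∈ U) (v : TangentSpace 𝓘(ℂ, V) y) :
    c.covDeriv (fun z => f z • s z) y v =
      f y • c.covDeriv s y v + mvfderiv 𝓘(ℂ, V) f y v • s y := by
  have hyy := mem_baseOpen_self F (E := E) y
  have h1 := (Sec.contMDiffAt_toTriv hs hy hyy).mdifferentiableAt (by simp)
  rw [c.covDeriv_apply, c.covDeriv_apply]
  simp only [map_smul, map_add]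
  rw [mvfderiv_fun_smul (hf.mdifferentiableAt (by simp)) h1]
  simp only [add_apply, smul_apply, ContinuousLinearMap.smulRight_apply, map_add, map_smul,
    ofTriv_toTriv hyy, smul_add]
  abel

variable [FiniteDimensional ℂ V] [∀ x, IsTopologicalAddGroup (E x)] [∀ x, ContinuousSMul ℂ (E x)]

/-- Off D the coordinate fields are logarithmic, so A is holomorphic on them and d + A can be tested
one coordinate direction at a time. -/
theorem ConnectionForms.covDeriv_mem_sec (c : ConnectionForms D F E) {U : Opens X} {s : Π x, E x}
    (hs : s ∈ Sec 𝓘(ℂ, V) F E U) :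
    restrictTo (D.away U) (c.covDeriv s) ∈ Sec 𝓘(ℂ, V) (V →L[ℂ] F)
      (fun x => TangentSpace 𝓘(ℂ, V) x →L[ℂ] E x) (D.away U) := by
  refine restrictTo_mem_sec fun x hx => contMDiffAt_hom_of_apply fun w => ?_
  have hxc := mem_baseOpen_self V (E := (TangentSpace 𝓘(ℂ, V) : X → Type _)) x
  have hxx := mem_baseOpen_self F (E := E) x
  have hxW : x ∈ D.away U ⊓ chartOpen V x := ⟨hx, hxc⟩
  have h1 := (c.extendsAt (constField_mem_TLog (D := D) (W := D.away U ⊓ chartOpen V x)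
    inf_le_right (fun y hy => hy.1.2) w) hxW hxx).contMDiffAt hx.2
  have h2 := contMDiffAt_mvfderiv_apply (Sec.contMDiffAt_toTriv hs hx.1 hxx)
    (contMDiffAt_ofTriv (F := V) (E := (TangentSpace 𝓘(ℂ, V) : X → Type _)) hxc
      (contMDiffAt_const (c := w)))
  refine (h2.add (h1.clm_apply (Sec.contMDiffAt_toTriv hs hx.1 hxx))).congr_of_eventuallyEq ?_
  filter_upwards [(D.away U ⊓ chartOpen V x).2.mem_nhds hxW, baseOpen_mem_nhds hxx] with z hz hz'
  have hz1 : z ∈ D.away U ⊓ chartOpen V x := hz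
  rw [c.toTriv_covDeriv hs hz.1.1 hz.1.2 hz']
  simp only [Pi.add_apply, restrictTo_of_mem _ hz1]

variable [FiniteDimensional ℂ F]

/-- Expand ∇s in the local frame of constant sections. Each coefficient is a scalar form whose value
on a logarithmic field v is a coordinate of ds(v) + A(v)s. This extends across D, so reflexivity
makes the coefficient logarithmic. -/
theorem ConnectionForms.isTensorLogForm_covDeriv (c : ConnectionForms D F E) {U : Opens X}
    {s : Π x, E x} (hs : s ∈ Sec 𝓘(ℂ, V) F E U) :
    IsTensorLogForm F E D U (restrictTo (D.away U) (c.covDeriv s)) := by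
  intro x hx
  have hxx := mem_baseOpen_self F (E := E) x
  let b := Module.finBasis ℂ F
  let coord : Fin (Module.finrank ℂ F) → F →L[ℂ] ℂ :=
    fun i => LinearMap.toContinuousLinearMap (b.coord i)
  set W : Opens X := U ⊓ baseOpen F E x with hW
  refine ⟨W, inf_le_left, ⟨hx, hxx⟩, Module.finrank ℂ F,
    fun i => restrictTo W (fun z => ofTriv F E x z (b i)),
    fun i => restrictTo (D.away W)
      (fun z => (coord i).comp ((toTriv F E x z).comp (c.covDeriv s z))),
    fun i => restrictTo_mem_sec fun y hy => contMDiffAt_ofTriv hy.2 contMDiffAt_const,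
    fun i => ?_, fun y hy hyD v => ?_⟩
  · refine isLogForm_of_extendsAt (fun y hy => restrictTo_of_notMem _ hy)
      fun W' hW' v hv y hy => ?_
    have hyb : y ∈ baseOpen F E x := (hW' hy).2
    have hs' := Sec.contMDiffAt_toTriv hs (hW' hy).1 hyb
    have h1 := (contMDiffAt_mvfderiv_apply hs'
      (Sec.contMDiffAt (mem_TLog_iff.1 hv).1 hy)).extendsAt (D := D)
    have h2 := (c.extendsAt hv hy hyb).clm_apply (hs'.extendsAt (D := D))
    refine ((h1.add h2).clm_comp (coord i)).congr ?_
    filter_upwards [W'.2.mem_nhds hy] with z hz hzD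
    have hzW : z ∈ D.away W := ⟨hW' hz, hzD⟩
    rw [restrictTo_of_mem _ hzW, ← c.toTriv_covDeriv hs (hW' hz).1 hzD (hW' hz).2]
    rfl
  · have hyW : y ∈ D.away W := ⟨hy, hyD⟩
    have hyU : y ∈ D.away U := ⟨hy.1, hyD⟩
    simp only [restrictTo_of_mem _ hyW, restrictTo_of_mem _ hyU, restrictTo_of_mem _ hy]
    conv_lhs => rw [← ofTriv_toTriv hy.2 (c.covDeriv s y v),
      ← b.sum_repr (toTriv F E x y (c.covDeriv s y v)), map_sum]
    refine Finset.sum_congr rfl fun i _ => ?_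
    rw [map_smul]
    rfl

/-- The logarithmic connection with given connection forms. -/
def ConnectionForms.toLogConnection (c : ConnectionForms D F E) : LogConnection F E D where
  nabla U :=
    { toFun := fun s => ⟨restrictTo (D.away U) (c.covDeriv s.1), c.covDeriv_mem_sec s.2⟩
      map_add' := fun s t => by
        refine Subtype.ext (funext fun y => ?_)
        by_cases hy : y ∈ D.away U
        · simp only [Submodule.coe_add, Pi.add_apply, restrictTo_of_mem _ hy]
          ext v
          exact c.covDeriv_add s.2 t.2 hy.1 v
        · simp only [Submodule.coe_add, Pi.add_apply, restrictTo_of_notMem _ hy, add_zero]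
      map_smul' := fun a s => by
        refine Subtype.ext (funext fun y => ?_)
        by_cases hy : y ∈ D.away U
        · simp only [Submodule.coe_smul, Pi.smul_apply, restrictTo_of_mem _ hy, RingHom.id_apply]
          ext v
          -- Homogeneity is the Leibniz rule for a constant function, whose differential vanishes.
          have h := c.covDeriv_smul s.2 (f := fun _ => a) contMDiffAt_const hy.1 v
          rw [mvfderiv_const] at h
          refine (?_ : c.covDeriv (fun z => a • s.1 z) y v = a • c.covDeriv s.1 y v)
          simpa using h
        · simp only [Submodule.coe_smul, Pi.smul_apply, restrictTo_of_notMem _ hy, smul_zero] }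
  isLog U s := c.isTensorLogForm_covDeriv s.2
  restrict U W hWU s := by
    funext y
    by_cases hy : y ∈ D.away W
    · have hyU : y ∈ D.away U := D.away_mono hWU hy
      simp only [LinearMap.coe_mk, AddHom.coe_mk, restrictTo_of_mem _ hy, restrictTo_of_mem _ hyU]
      refine c.covDeriv_congr ?_
      filter_upwards [W.2.mem_nhds hy.1] with z hz
      exact restrictTo_of_mem _ hz
    · simp only [LinearMap.coe_mk, AddHom.coe_mk, restrictTo_of_notMem _ hy]
  leibniz U f hf s x hx := by
    simp only [LinearMap.coe_mk, AddHom.coe_mk, restrictTo_of_mem _ hx]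
    ext v
    exact c.covDeriv_smul s.2 (hf.contMDiffAt (U.2.mem_nhds hx.1)) hx.1 v

end

end LogAtiyah

end

noncomputable section

namespace LogAtiyah

/-! ### From a logarithmic connection to its connection forms -/

section

variable {V : Type*} [NormedAddCommGroup V] [NormedSpace ℂ V]
  {X : Type*} [TopologicalSpace X] [ChartedSpace V X] [IsManifold 𝓘(ℂ, V) ω X]
  {D : ReducedDivisor V X}
  {F : Type*} [NormedAddCommGroup F] [NormedSpace ℂ F]
  {E : X → Type*} [TopologicalSpace (TotalSpace F E)]
  [∀ x, AddCommGroup (E x)] [∀ x, Module ℂ (E x)] [∀ x, TopologicalSpace (E x)]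
  [FiberBundle F E] [VectorBundle ℂ F E] [ContMDiffVectorBundle ω F E 𝓘(ℂ, V)]

variable (V F E) in
/-- The sections of `E` that are constant in the trivialization at `x₀`. -/
def constSec (x₀ : X) : F →ₗ[ℂ] Sec 𝓘(ℂ, V) F E (baseOpen F E x₀) where
  toFun w := ⟨restrictTo (baseOpen F E x₀) (fun z => ofTriv F E x₀ z w),
    restrictTo_mem_sec fun _ hy => contMDiffAt_ofTriv hy contMDiffAt_const⟩
  map_add' w w' := by
    refine Subtype.ext (funext fun y => ?_)
    by_cases hy : y ∈ baseOpen F E x₀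
    · simp [restrictTo_of_mem _ hy]
    · simp [restrictTo_of_notMem _ hy]
  map_smul' a w := by
    refine Subtype.ext (funext fun y => ?_)
    by_cases hy : y ∈ baseOpen F E x₀
    · simp [restrictTo_of_mem _ hy]
    · simp [restrictTo_of_notMem _ hy]

theorem constSec_apply {x₀ z : X} (hz : z ∈ baseOpen F E x₀) (w : F) :
    (constSec V F E x₀ w).1 z = ofTriv F E x₀ z w :=
  restrictTo_of_mem (fun z => ofTriv F E x₀ z w) hz

variable [∀ x, IsTopologicalAddGroup (E x)] [∀ x, ContinuousSMul ℂ (E x)] [FiniteDimensional ℂ F]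

/-- The connection form of `∇` in the trivialization at `x₀`. -/
def LogConnection.connectionForm (n : LogConnection F E D) (x₀ y : X) :
    TangentSpace 𝓘(ℂ, V) y →L[ℂ] (F →L[ℂ] F) :=
  -- The natural order is w ↦ ∇(constant section w), linear in w and continuous because F is
  -- finite-dimensional; flipping puts the tangent vector first.
  ContinuousLinearMap.flip (E := F) (F := V) (LinearMap.toContinuousLinearMap
    { toFun := fun w => ((toTriv F E x₀ y).comp ((n.nabla _ (constSec V F E x₀ w)).1 y) : V →L[ℂ] F)
      map_add' := fun w w' => by
        ext v
        rw [map_add, map_add]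
        exact map_add (toTriv F E x₀ y) _ _
      map_smul' := fun a w => by
        ext v
        rw [map_smul, map_smul]
        exact map_smul (toTriv F E x₀ y) _ _ })

theorem LogConnection.connectionForm_apply (n : LogConnection F E D) (x₀ y : X)
    (v : TangentSpace 𝓘(ℂ, V) y) (w : F) :
    n.connectionForm x₀ y v w = toTriv F E x₀ y ((n.nabla _ (constSec V F E x₀ w)).1 y v) := rfl

theorem LogConnection.nabla_restrict_apply (n : LogConnection F E D) {U W : Opens X} (hWU : W ≤ U)
    (s : Sec 𝓘(ℂ, V) F E U) {y : X} (hy : y ∈ D.away W) :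
    (n.nabla W ⟨restrictTo W s.1, Sec.restrict_mem hWU s.2⟩).1 y = (n.nabla U s).1 y := by
  rw [n.restrict U W hWU s, restrictTo_of_mem _ hy]

/-- Near y write s = ∑ fᵢrᵢ with rᵢ constant in the trivialization. Leibniz gives ∇s = ∑ fᵢ∇rᵢ + ∑
dfᵢ rᵢ: the first sum is A applied to s, the second is the derivative of the coordinates of s. -/
theorem LogConnection.toTriv_nabla (n : LogConnection F E D) {U : Opens X}
    (s : Sec 𝓘(ℂ, V) F E U) {x₀ y : X} (hy : y ∈ D.away U) (hy₀ : y ∈ baseOpen F E x₀)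
    (v : TangentSpace 𝓘(ℂ, V) y) :
    toTriv F E x₀ y ((n.nabla U s).1 y v) =
      mvfderiv 𝓘(ℂ, V) (fun z => toTriv F E x₀ z (s.1 z)) y v +
        n.connectionForm x₀ y v (toTriv F E x₀ y (s.1 y)) := by
  set U' : Opens X := U ⊓ baseOpen F E x₀ with hU'
  have hyU' : y ∈ D.away U' := ⟨⟨hy.1, hy₀⟩, hy.2⟩
  let b := Module.finBasis ℂ F
  let coord : Fin (Module.finrank ℂ F) → F →L[ℂ] ℂ :=
    fun i => LinearMap.toContinuousLinearMap (b.coord i)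
  let r : Fin (Module.finrank ℂ F) → Sec 𝓘(ℂ, V) F E U' := fun i =>
    ⟨restrictTo U' (constSec V F E x₀ (b i)).1,
      Sec.restrict_mem inf_le_right (constSec V F E x₀ (b i)).2⟩
  let f : Fin (Module.finrank ℂ F) → X → ℂ := fun i z => coord i (toTriv F E x₀ z (s.1 z))
  have hf : ∀ i, ContMDiffOn 𝓘(ℂ, V) 𝓘(ℂ) ω (f i) U' := fun i z hz =>
    ((coord i).contMDiff.contMDiffAt.comp z
      (Sec.contMDiffAt_toTriv s.2 hz.1 hz.2)).contMDiffWithinAt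
  have hs : (⟨restrictTo U' s.1, Sec.restrict_mem inf_le_left s.2⟩ : Sec 𝓘(ℂ, V) F E U') =
      ∑ i, (⟨fun z => f i z • (r i).1 z, Sec.smul_mem (hf i) (r i).2⟩ :
        Sec 𝓘(ℂ, V) F E U') := by
    refine Subtype.ext (funext fun z => ?_)
    rw [AddSubmonoidClass.coe_finsetSum, Finset.sum_apply]
    by_cases hz : z ∈ U'
    · simp only [r, f, restrictTo_of_mem _ hz, constSec_apply hz.2]
      conv_lhs => rw [← ofTriv_toTriv hz.2 (s.1 z), ← b.sum_repr (toTriv F E x₀ z (s.1 z)), map_sum]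
      refine Finset.sum_congr rfl fun i _ => ?_
      rw [map_smul]
      rfl
    · simp only [r, restrictTo_of_notMem _ hz, smul_zero, Finset.sum_const_zero]
  have h1 := n.nabla_restrict_apply inf_le_left s hyU'
  rw [hs, map_sum, AddSubmonoidClass.coe_finsetSum, Finset.sum_apply] at h1
  rw [← h1, sum_apply, map_sum]
  have h2 : ∀ i, toTriv F E x₀ y
      ((n.nabla U' ⟨fun z => f i z • (r i).1 z, Sec.smul_mem (hf i) (r i).2⟩).1 y v) =
      f i y • n.connectionForm x₀ y v (b i) +
        coord i (mvfderiv 𝓘(ℂ, V) (fun z => toTriv F E x₀ z (s.1 z)) y v) • b i := fun i => by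
    rw [n.leibniz U' (f i) (hf i) (r i) y hyU', n.nabla_restrict_apply inf_le_right _ hyU',
      n.connectionForm_apply, ← mvfderiv_const_apply (coord i)
        (Sec.contMDiffAt_toTriv s.2 hy.1 hy₀)]
    have hr : (r i).1 y = ofTriv F E x₀ y (b i) := by
      simp only [r, restrictTo_of_mem _ hyU'.1, constSec_apply hy₀]
    rw [hr, add_apply, smul_apply, ContinuousLinearMap.smulRight_apply, map_add, map_smul, map_smul,
      toTriv_ofTriv hy₀]
  rw [Finset.sum_congr rfl fun i _ => h2 i, Finset.sum_add_distrib, add_comm]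
  congr 1
  · exact b.sum_repr _
  · conv_rhs => rw [← b.sum_repr (toTriv F E x₀ y (s.1 y)), map_sum]
    refine Finset.sum_congr rfl fun i _ => ?_
    rw [map_smul]
    rfl

/-- The connection forms of a logarithmic connection. -/
def LogConnection.toConnectionForms (n : LogConnection F E D) : ConnectionForms D F E where
  form := n.connectionForm
  extendsAt_form x₀ U hU v hv x hx := by
    refine ExtendsAt.clm_of_apply fun w => ?_
    -- A(v)w is ∇ of a constant section evaluated on v. Locally this is ∑ αᵢ(v)sᵢ with αᵢ
    -- logarithmic, and each αᵢ(v) extends.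
    obtain ⟨W, hW, hxW, k, s, α, hs, hα, hsum⟩ := n.isLog _ (constSec V F E x₀ w) x (hU hx)
    have h1 : ExtendsAt D (fun y => ∑ i, (α i y (v y) : ℂ) • toTriv F E x₀ y (s i y)) x :=
      ExtendsAt.sum _ fun i _ => (TLog.extendsAt hv (hα i) hx hxW).smul
        (Sec.contMDiffAt_toTriv (hs i) hxW (hU hx)).extendsAt
    refine h1.congr ?_
    filter_upwards [W.2.mem_nhds hxW] with y hy hyD
    rw [n.connectionForm_apply, hsum y hy hyD, map_sum]
    exact Finset.sum_congr rfl fun i _ => (map_smul _ _ _).symm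
  gauge x₀ x₁ y h₀ h₁ hyD v := by
    ext w
    -- The gauge rule is the formula d + A₁ applied, in the trivialization at x₁, to a section
    -- constant in the one at x₀; its coordinate there is Tw.
    have h := n.toTriv_nabla (constSec V F E x₀ w) (x₀ := x₁) ⟨h₀, hyD⟩ h₁ v
    have h2 : (fun z => toTriv F E x₁ z ((constSec V F E x₀ w).1 z)) =ᶠ[𝓝 y]
        fun z => transition F E x₀ x₁ z w := by
      filter_upwards [baseOpen_mem_nhds h₀] with z hz
      rw [constSec_apply hz]
      rfl
    rw [mvfderiv_congr h2, mvfderiv_apply_const (contMDiffAt_transition h₀ h₁),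
      ← transition_toTriv h₀, constSec_apply h₀] at h
    exact h.symm

end

end LogAtiyah

end

noncomputable section

namespace LogAtiyah

/-! ### Vector fields on products with a vector space -/

section ProductField

variable {V : Type*} [NormedAddCommGroup V] [NormedSpace ℂ V]
  {X : Type*} [TopologicalSpace X] [ChartedSpace V X] [IsManifold 𝓘(ℂ, V) ω X]
  {Z : Type*} [NormedAddCommGroup Z] [NormedSpace ℂ Z]

/-- The vector field on `X × Z` with given components. -/
def prodField (v : Π x : X, TangentSpace 𝓘(ℂ, V) x) (N : X × Z → Z) (z : X × Z) :
    TangentSpace (𝓘(ℂ, V).prod 𝓘(ℂ, Z)) z := (v z.1, N z)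

theorem contMDiffAt_prodField {v : Π x : X, TangentSpace 𝓘(ℂ, V) x} {N : X × Z → Z} {z : X × Z}
    (hv : ContMDiffAt 𝓘(ℂ, V) (𝓘(ℂ, V).prod 𝓘(ℂ, V)) ω (fun x => TotalSpace.mk' V x (v x)) z.1)
    (hN : ContMDiffAt (𝓘(ℂ, V).prod 𝓘(ℂ, Z)) 𝓘(ℂ, Z) ω N z) :
    ContMDiffAt (𝓘(ℂ, V).prod 𝓘(ℂ, Z)) ((𝓘(ℂ, V).prod 𝓘(ℂ, Z)).prod 𝓘(ℂ, V × Z)) ω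
      (fun y => TotalSpace.mk' (V × Z) y (prodField v N y)) z := by
  have h1 : ContMDiffAt (𝓘(ℂ, V).prod 𝓘(ℂ, Z)) 𝓘(ℂ, V).tangent ω
      (fun y : X × Z => (⟨y.1, v y.1⟩ : TangentBundle 𝓘(ℂ, V) X)) z :=
    hv.comp z contMDiffAt_fst
  have h2 : ContMDiffAt (𝓘(ℂ, V).prod 𝓘(ℂ, Z)) 𝓘(ℂ, Z).tangent ω
      (fun y : X × Z => (⟨y.2, N y⟩ : TangentBundle 𝓘(ℂ, Z) Z)) z := by
    refine contMDiffAt_totalSpace.2 ⟨contMDiffAt_snd, ?_⟩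
    refine hN.congr_of_eventuallyEq (Filter.Eventually.of_forall fun y => ?_)
    simp
  have h3 := (contMDiff_equivTangentBundleProd_symm (n := ω) (I := 𝓘(ℂ, V)) (M := X)
    (I' := 𝓘(ℂ, Z)) (M' := Z)).contMDiffAt.comp z (h1.prodMk h2)
  exact h3

end ProductField

/-! ### The geometry of the frame bundle -/

section FrameGeometry

variable {V : Type*} [NormedAddCommGroup V] [NormedSpace ℂ V]
  {X : Type*} [TopologicalSpace X] [ChartedSpace V X] [IsManifold 𝓘(ℂ, V) ω X]
  {n : ℕ} {E : X → Type*} [TopologicalSpace (TotalSpace (Fin n → ℂ) E)]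
  [∀ x, AddCommGroup (E x)] [∀ x, Module ℂ (E x)] [∀ x, TopologicalSpace (E x)]
  [∀ x, IsTopologicalAddGroup (E x)] [∀ x, ContinuousSMul ℂ (E x)]
  [FiberBundle (Fin n → ℂ) E] [VectorBundle ℂ (Fin n → ℂ) E]
  [ContMDiffVectorBundle ω (Fin n → ℂ) E 𝓘(ℂ, V)]

variable (n) in
/-- The endomorphisms of `ℂⁿ`. -/
abbrev EndC : Type := (Fin n → ℂ) →L[ℂ] (Fin n → ℂ)

variable (V n) in
/-- The model with corners of the frame bundle. -/
abbrev frameModel : ModelWithCorners ℂ (V × EndC n) (ModelProd V (EndC n)) :=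
  𝓘(ℂ, V).prod 𝓘(ℂ, EndC n)

/-- The matrix of a frame in the trivialization at `x₀`. -/
def frameCoord (x₀ : X) (q : frames n E) : EndC n :=
  (toTriv (Fin n → ℂ) E x₀ q.1.1).comp (q.1.2 : (Fin n → ℂ) →L[ℂ] E q.1.1)

theorem frameCoord_bijective {x₀ : X} {q : frames n E}
    (hq : frameProj n E q ∈ baseOpen (Fin n → ℂ) E x₀) : Function.Bijective (frameCoord x₀ q) := by
  have h : Function.Bijective (toTriv (Fin n → ℂ) E x₀ (frameProj n E q)) :=
    ⟨toTriv_injective hq, fun w => ⟨_, toTriv_ofTriv hq w⟩⟩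
  exact h.comp q.2

theorem frame_ext {x₀ : X} {q q' : frames n E}
    (hq : frameProj n E q ∈ baseOpen (Fin n → ℂ) E x₀) (hp : frameProj n E q = frameProj n E q')
    (hc : frameCoord x₀ q = frameCoord x₀ q') : q = q' := by
  obtain ⟨⟨x, A⟩, hA⟩ := q
  obtain ⟨⟨x', A'⟩, hA'⟩ := q'
  obtain rfl : x = x' := hp
  refine Subtype.ext (TotalSpace.ext rfl (heq_of_eq (ContinuousLinearMap.ext fun w => ?_)))
  exact toTriv_injective hq (congrArg (fun L : EndC n => L w) hc)

theorem frameCoord_eq_transition {x₀ x₁ : X} {q : frames n E}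
    (hq : frameProj n E q ∈ baseOpen (Fin n → ℂ) E x₀) :
    frameCoord x₁ q =
      (transition (Fin n → ℂ) E x₀ x₁ (frameProj n E q)).comp (frameCoord x₀ q) := by
  ext1 w
  exact (transition_toTriv hq _).symm

theorem snd_trivializationAt_hom (x₀ : X) (q : HomTotal n E) :
    (trivializationAt (EndC n) (fun x => Trivial X (Fin n → ℂ) x →L[ℂ] E x) x₀ q).2 =
      (toTriv (Fin n → ℂ) E x₀ q.1).comp (q.2 : (Fin n → ℂ) →L[ℂ] E q.1) := by
  rw [hom_trivializationAt_apply]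
  ext1 w
  simp [ContinuousLinearMap.inCoordinates, toTriv]

variable {M : Type*} [TopologicalSpace M] {B : Type*} [NormedAddCommGroup B] [NormedSpace ℂ B]
  {H : Type*} [TopologicalSpace H] {I : ModelWithCorners ℂ B H} [ChartedSpace H M]

/-- The frame bundle is open in the total space of Hom(ℂⁿ, E), and the fibre coordinate of that
bundle restricts to `frameCoord`. Holomorphy into it therefore means holomorphy of base point and
matrix. -/
theorem contMDiffAt_frames_iff {φ : M → frames n E} {m : M} {x₀ : X}
    (hm : frameProj n E (φ m) ∈ baseOpen (Fin n → ℂ) E x₀) :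
    ContMDiffAt I (frameModel V n) ω φ m ↔
      ContMDiffAt I 𝓘(ℂ, V) ω (fun y => frameProj n E (φ y)) m ∧
        ContMDiffAt I 𝓘(ℂ, EndC n) ω (fun y => frameCoord x₀ (φ y)) m := by
  have h1 : ContMDiffAt I (frameModel V n) ω φ m ↔
      ContMDiffAt I (frameModel V n) ω (fun y => (φ y).1) m :=
    (ChartedSpace.liftPropWithinAt_subtypeVal_comp_iff ..).symm
  rw [h1, (trivializationAt (EndC n)
    (fun x => Trivial X (Fin n → ℂ) x →L[ℂ] E x) x₀).contMDiffAt_iff]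
  · simp only [snd_trivializationAt_hom]
    rfl
  · rw [Trivialization.mem_source, hom_trivializationAt_baseSet]
    exact ⟨trivial, hm⟩

theorem contMDiff_frameProj : ContMDiff (frameModel V n) 𝓘(ℂ, V) ω (frameProj n E) := fun q =>
  ((contMDiffAt_frames_iff (φ := id) (mem_baseOpen_self _ (frameProj n E q))).1 contMDiffAt_id).1

theorem contMDiffAt_frameCoord {x₀ : X} {q : frames n E}
    (hq : frameProj n E q ∈ baseOpen (Fin n → ℂ) E x₀) :
    ContMDiffAt (frameModel V n) 𝓘(ℂ, EndC n) ω (frameCoord (n := n) (E := E) x₀) q :=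
  ((contMDiffAt_frames_iff (φ := id) hq).1 contMDiffAt_id).2

open Classical in
/-- The frame at `z.1` whose matrix in the trivialization at `x₀` is `z.2`, if there is one, and any
frame at `z.1` otherwise. -/
def mkFrame (x₀ : X) (z : X × EndC n) : frames n E :=
  if h : Function.Bijective ((ofTriv (Fin n → ℂ) E x₀ z.1).comp z.2) then
    ⟨⟨z.1, (ofTriv (Fin n → ℂ) E x₀ z.1).comp z.2⟩, h⟩
  else (frameProj_surjective n E z.1).choose

@[simp]
theorem frameProj_mkFrame (x₀ : X) (z : X × EndC n) :
    frameProj n E (mkFrame x₀ z) = z.1 := by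
  unfold mkFrame
  split_ifs with h
  · rfl
  · exact (frameProj_surjective n E z.1).choose_spec

theorem frameCoord_mkFrame {x₀ : X} {z : X × EndC n} (hz : z.1 ∈ baseOpen (Fin n → ℂ) E x₀)
    (hA : Function.Bijective z.2) :
    frameCoord x₀ (mkFrame (E := E) x₀ z) = z.2 := by
  have h₀ : Function.Bijective (ofTriv (Fin n → ℂ) E x₀ z.1) :=
    ⟨Function.LeftInverse.injective (toTriv_ofTriv hz), fun s => ⟨_, ofTriv_toTriv hz s⟩⟩
  have h : Function.Bijective ((ofTriv (Fin n → ℂ) E x₀ z.1).comp z.2) := h₀.comp hA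
  rw [mkFrame, dif_pos h]
  ext1 w
  exact toTriv_ofTriv hz _

theorem contMDiffAt_mkFrame {x₀ : X} {z : X × EndC n} (hz : z.1 ∈ baseOpen (Fin n → ℂ) E x₀)
    (hA : Function.Bijective z.2) :
    ContMDiffAt (frameModel V n) (frameModel V n) ω (mkFrame (E := E) x₀) z := by
  refine (contMDiffAt_frames_iff (x₀ := x₀) (by rwa [frameProj_mkFrame])).2 ⟨?_, ?_⟩
  · simp only [frameProj_mkFrame]
    exact contMDiffAt_fst
  · refine contMDiffAt_snd.congr_of_eventuallyEq ?_
    filter_upwards [continuousAt_fst.eventually (baseOpen_mem_nhds hz),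
      continuousAt_snd.eventually ((isOpen_bijective n).mem_nhds hA)] with y hy1 hy2
    exact frameCoord_mkFrame hy1 hy2

/-- The trivialization of the frame bundle over the domain of the trivialization at `x₀`. -/
def frameChart (x₀ : X) (q : frames n E) : X × EndC n := (frameProj n E q, frameCoord x₀ q)

theorem contMDiffAt_frameChart {x₀ : X} {q : frames n E}
    (hq : frameProj n E q ∈ baseOpen (Fin n → ℂ) E x₀) :
    ContMDiffAt (frameModel V n) (frameModel V n) ω (frameChart (n := n) (E := E) x₀) q :=
  contMDiff_frameProj.contMDiffAt.prodMk (contMDiffAt_frameCoord hq)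

theorem mkFrame_frameChart {x₀ : X} {q : frames n E}
    (hq : frameProj n E q ∈ baseOpen (Fin n → ℂ) E x₀) : mkFrame x₀ (frameChart x₀ q) = q := by
  refine frame_ext (x₀ := x₀) ?_ (frameProj_mkFrame _ _) ?_
  · rw [frameProj_mkFrame]; exact hq
  · exact frameCoord_mkFrame hq (frameCoord_bijective hq)

theorem eventually_frameProj_mem {x₀ : X} {q : frames n E}
    (hq : frameProj n E q ∈ baseOpen (Fin n → ℂ) E x₀) :
    ∀ᶠ q' in 𝓝 q, frameProj n E q' ∈ baseOpen (Fin n → ℂ) E x₀ :=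
  (frameProj n E).continuous.continuousAt.eventually (baseOpen_mem_nhds hq)

/-- `mkFrame x₀` is a local holomorphic inverse, so the chain rule makes the two derivatives
mutually inverse. -/
theorem isInvertible_mfderiv_frameChart {x₀ : X} {q : frames n E}
    (hq : frameProj n E q ∈ baseOpen (Fin n → ℂ) E x₀) :
    (mfderiv (frameModel V n) (frameModel V n) (frameChart (n := n) (E := E) x₀) q).IsInvertible := by
  have hA := frameCoord_bijective hq
  have hg := (contMDiffAt_frameChart (V := V) hq).mdifferentiableAt (by simp)
  have hm : MDifferentiableAt (frameModel V n) (frameModel V n) (mkFrame (E := E) x₀)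
      (frameChart x₀ q) := (contMDiffAt_mkFrame (z := frameChart x₀ q) hq hA).mdifferentiableAt (by simp)
  have hmq := mkFrame_frameChart hq
  refine ContinuousLinearMap.IsInvertible.of_inverse
    (g := (mfderiv (frameModel V n) (frameModel V n) (mkFrame (E := E) x₀) (frameChart x₀ q) :
      V × EndC n →L[ℂ] V × EndC n)) ?_ ?_
  · have h1 : frameChart x₀ ∘ mkFrame (E := E) x₀ =ᶠ[𝓝 (frameChart x₀ q)] id := by
      filter_upwards [continuousAt_fst.eventually (baseOpen_mem_nhds (x := (frameChart x₀ q).1) hq),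
        continuousAt_snd.eventually ((isOpen_bijective n).mem_nhds hA)] with y hy1 hy2
      exact Prod.ext (frameProj_mkFrame _ _) (frameCoord_mkFrame hy1 hy2)
    have h2 := mfderiv_comp_of_eq (x := frameChart x₀ q) (g := frameChart (n := n) (E := E) x₀)
      hg hm hmq
    rw [h1.mfderiv_eq, mfderiv_id, hmq] at h2
    exact h2.symm
  · have h1 : mkFrame (E := E) x₀ ∘ frameChart x₀ =ᶠ[𝓝 q] id := by
      filter_upwards [eventually_frameProj_mem hq] with q' hq'
      exact mkFrame_frameChart hq'
    have h2 := mfderiv_comp q hm hg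
    rw [h1.mfderiv_eq, mfderiv_id] at h2
    exact h2.symm

end FrameGeometry

end LogAtiyah

end

noncomputable section

namespace LogAtiyah

theorem mvfderiv_fun_comp_apply {B B' : Type*} [NormedAddCommGroup B] [NormedSpace ℂ B]
    [NormedAddCommGroup B'] [NormedSpace ℂ B'] {H H' : Type*} [TopologicalSpace H]
    [TopologicalSpace H'] {I : ModelWithCorners ℂ B H} {I' : ModelWithCorners ℂ B' H'}
    {M M' : Type*} [TopologicalSpace M] [ChartedSpace H M] [TopologicalSpace M']
    [ChartedSpace H' M'] {Z : Type*} [NormedAddCommGroup Z] [NormedSpace ℂ Z] {g : M → Z}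
    {f : M' → M} (x : M') (hg : MDifferentiableAt I 𝓘(ℂ, Z) g (f x))
    (hf : MDifferentiableAt I' I f x) (v : TangentSpace I' x) :
    mvfderiv I' (fun y => g (f y)) x v = mvfderiv I g (f x) (mfderiv I' I f x v) :=
  mfderiv_comp_apply x hg hf v

/-! ### Tangent vectors of the frame bundle -/

section FrameTangent

variable {V : Type*} [NormedAddCommGroup V] [NormedSpace ℂ V]
  {X : Type*} [TopologicalSpace X] [ChartedSpace V X] [IsManifold 𝓘(ℂ, V) ω X]
  {n : ℕ} {E : X → Type*} [TopologicalSpace (TotalSpace (Fin n → ℂ) E)]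
  [∀ x, AddCommGroup (E x)] [∀ x, Module ℂ (E x)] [∀ x, TopologicalSpace (E x)]
  [∀ x, IsTopologicalAddGroup (E x)] [∀ x, ContinuousSMul ℂ (E x)]
  [FiberBundle (Fin n → ℂ) E] [VectorBundle ℂ (Fin n → ℂ) E]
  [ContMDiffVectorBundle ω (Fin n → ℂ) E 𝓘(ℂ, V)]

theorem mfderiv_frameChart_apply {x₀ : X} {q : frames n E}
    (hq : frameProj n E q ∈ baseOpen (Fin n → ℂ) E x₀) (ξ : TangentSpace (frameModel V n) q) :
    mfderiv (frameModel V n) (frameModel V n) (frameChart (n := n) (E := E) x₀) q ξ =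
      (show V × EndC n from (mfderiv (frameModel V n) 𝓘(ℂ, V) (frameProj n E) q ξ,
        mvfderiv (frameModel V n) (frameCoord (n := n) (E := E) x₀) q ξ)) :=
  congrArg (fun L : V × EndC n →L[ℂ] V × EndC n => L ξ)
    (mfderiv_prodMk (contMDiff_frameProj.contMDiffAt.mdifferentiableAt (by simp))
      ((contMDiffAt_frameCoord (V := V) hq).mdifferentiableAt (by simp)))

/-- A tangent vector of the frame bundle is known from its base and matrix components; later
identities between lifts are checked on these two. -/
theorem frameTangent_ext {x₀ : X} {q : frames n E}
    (hq : frameProj n E q ∈ baseOpen (Fin n → ℂ) E x₀) {ξ ζ : TangentSpace (frameModel V n) q}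
    (hp : mfderiv (frameModel V n) 𝓘(ℂ, V) (frameProj n E) q ξ =
      mfderiv (frameModel V n) 𝓘(ℂ, V) (frameProj n E) q ζ)
    (hc : mvfderiv (frameModel V n) (frameCoord (n := n) (E := E) x₀) q ξ =
      mvfderiv (frameModel V n) (frameCoord (n := n) (E := E) x₀) q ζ) : ξ = ζ := by
  obtain ⟨e, he⟩ := isInvertible_mfderiv_frameChart (V := V) hq
  refine e.injective ?_
  have h := (mfderiv_frameChart_apply hq ξ).trans
    ((Prod.ext hp hc : _ = _).trans (mfderiv_frameChart_apply hq ζ).symm)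
  rw [← he] at h
  exact h

/-- The tangent vector at `q` with components `v` and `A` in the trivialization at `x₀`. -/
def frameLift (x₀ : X) (q : frames n E) (v : TangentSpace 𝓘(ℂ, V) (frameProj n E q))
    (A : EndC n) : TangentSpace (frameModel V n) q :=
  (mfderiv (frameModel V n) (frameModel V n) (frameChart (n := n) (E := E) x₀) q).inverse
    (show V × EndC n from (v, A))

theorem mfderiv_frameChart_frameLift {x₀ : X} {q : frames n E}
    (hq : frameProj n E q ∈ baseOpen (Fin n → ℂ) E x₀)
    (v : TangentSpace 𝓘(ℂ, V) (frameProj n E q)) (A : EndC n) :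
    mfderiv (frameModel V n) (frameModel V n) (frameChart (n := n) (E := E) x₀) q
      (frameLift x₀ q v A) = (show V × EndC n from (v, A)) :=
  (isInvertible_mfderiv_frameChart (V := V) hq).self_apply_inverse _

theorem mfderiv_frameProj_frameLift {x₀ : X} {q : frames n E}
    (hq : frameProj n E q ∈ baseOpen (Fin n → ℂ) E x₀)
    (v : TangentSpace 𝓘(ℂ, V) (frameProj n E q)) (A : EndC n) :
    mfderiv (frameModel V n) 𝓘(ℂ, V) (frameProj n E) q (frameLift x₀ q v A) = v :=
  congrArg Prod.fst ((mfderiv_frameChart_apply hq _).symm.trans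
    (mfderiv_frameChart_frameLift hq v A))

theorem mvfderiv_frameCoord_frameLift {x₀ : X} {q : frames n E}
    (hq : frameProj n E q ∈ baseOpen (Fin n → ℂ) E x₀)
    (v : TangentSpace 𝓘(ℂ, V) (frameProj n E q)) (A : EndC n) :
    mvfderiv (frameModel V n) (frameCoord (n := n) (E := E) x₀) q (frameLift x₀ q v A) = A :=
  congrArg Prod.snd ((mfderiv_frameChart_apply hq _).symm.trans
    (mfderiv_frameChart_frameLift hq v A))

/-- Differentiate C₁ = T C₀. The term dT is the source of the inhomogeneous part of the gauge rule.
-/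
theorem mvfderiv_frameCoord_eq_transition {x₀ x₁ : X} {q : frames n E}
    (h₀ : frameProj n E q ∈ baseOpen (Fin n → ℂ) E x₀)
    (h₁ : frameProj n E q ∈ baseOpen (Fin n → ℂ) E x₁) (ξ : TangentSpace (frameModel V n) q) :
    mvfderiv (frameModel V n) (frameCoord (n := n) (E := E) x₁) q ξ =
      (mvfderiv 𝓘(ℂ, V) (transition (Fin n → ℂ) E x₀ x₁) (frameProj n E q)
        (mfderiv (frameModel V n) 𝓘(ℂ, V) (frameProj n E) q ξ)).comp (frameCoord x₀ q) +
      (transition (Fin n → ℂ) E x₀ x₁ (frameProj n E q)).comp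
        (mvfderiv (frameModel V n) (frameCoord (n := n) (E := E) x₀) q ξ) := by
  have hT : ContMDiffAt 𝓘(ℂ, V) 𝓘(ℂ, EndC n) ω (transition (Fin n → ℂ) E x₀ x₁)
    (frameProj n E q) := contMDiffAt_transition h₀ h₁
  have hTp : ContMDiffAt (frameModel V n) 𝓘(ℂ, EndC n) ω
      (fun q' => transition (Fin n → ℂ) E x₀ x₁ (frameProj n E q')) q :=
    hT.comp q contMDiff_frameProj.contMDiffAt
  have h := mvfderiv_fun_comp_apply (I := 𝓘(ℂ, V)) (I' := frameModel V n)
    (g := transition (Fin n → ℂ) E x₀ x₁) (f := frameProj n E) q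
    (hT.mdifferentiableAt (by simp))
    (contMDiff_frameProj.contMDiffAt.mdifferentiableAt (by simp)) ξ
  rw [← h, ← mvfderiv_clm_comp (J := frameModel V n) hTp (contMDiffAt_frameCoord h₀)]
  refine mvfderiv_congr ?_ ξ
  filter_upwards [eventually_frameProj_mem h₀] with q' hq'
  exact frameCoord_eq_transition hq'

/-! ### The action of the structure group -/

theorem frameCoord_smul (x₀ : X) (g : GL (Fin n) ℂ) (q : frames n E) :
    frameCoord x₀ (MulOpposite.op g • q) = (frameCoord x₀ q).comp (glMap g) := rfl

theorem frameProj_smul (g : (GL (Fin n) ℂ)ᵐᵒᵖ) (q : frames n E) :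
    frameProj n E (g • q) = frameProj n E q := rfl

theorem contMDiff_frame_smul (g : GL (Fin n) ℂ) :
    ContMDiff (frameModel V n) (frameModel V n) ω
      (fun q : frames n E => MulOpposite.op g • q) := fun q => by
  have hq := mem_baseOpen_self (Fin n → ℂ) (E := E) (frameProj n E q)
  refine (contMDiffAt_frames_iff (x₀ := frameProj n E q) hq).2 ⟨contMDiff_frameProj q, ?_⟩
  simp only [frameCoord_smul]
  exact (contMDiffAt_frameCoord hq).clm_comp contMDiffAt_const

theorem mfderiv_frameProj_smul (g : GL (Fin n) ℂ) (q : frames n E)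
    (ξ : TangentSpace (frameModel V n) q) :
    mfderiv (frameModel V n) 𝓘(ℂ, V) (frameProj n E) (MulOpposite.op g • q)
      (mfderiv (frameModel V n) (frameModel V n)
        (fun q' : frames n E => MulOpposite.op g • q') q ξ) =
      mfderiv (frameModel V n) 𝓘(ℂ, V) (frameProj n E) q ξ :=
  congrArg (fun L : V × EndC n →L[ℂ] V => L ξ) (mfderiv_comp q
    (contMDiff_frameProj.contMDiffAt.mdifferentiableAt (by simp))
    ((contMDiff_frame_smul g).contMDiffAt.mdifferentiableAt (by simp))).symm

theorem mvfderiv_frameCoord_smul {x₀ : X} (g : GL (Fin n) ℂ) {q : frames n E}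
    (hq : frameProj n E q ∈ baseOpen (Fin n → ℂ) E x₀) (ξ : TangentSpace (frameModel V n) q) :
    mvfderiv (frameModel V n) (frameCoord (n := n) (E := E) x₀) (MulOpposite.op g • q)
      (mfderiv (frameModel V n) (frameModel V n)
        (fun q' : frames n E => MulOpposite.op g • q') q ξ) =
      (mvfderiv (frameModel V n) (frameCoord (n := n) (E := E) x₀) q ξ).comp (glMap g) := by
  have hq' : frameProj n E (MulOpposite.op g • q) ∈ baseOpen (Fin n → ℂ) E x₀ := hq
  have h' := mvfderiv_fun_comp_apply (I := frameModel V n) (I' := frameModel V n) q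
    (f := fun q' : frames n E => MulOpposite.op g • q') (g := frameCoord (n := n) (E := E) x₀)
    ((contMDiffAt_frameCoord hq').mdifferentiableAt (by simp))
    ((contMDiff_frame_smul g).contMDiffAt.mdifferentiableAt (by simp)) ξ
  have h := mvfderiv_clm_comp (J := frameModel V n) (contMDiffAt_frameCoord (V := V) hq)
    (contMDiffAt_const (c := glMap g)) ξ
  rw [mvfderiv_const] at h
  refine h'.symm.trans (h.trans ?_)
  simp

end FrameTangent

end LogAtiyah

end

noncomputable section

namespace LogAtiyah

/-! ### From connection forms to splittings -/

section Horizontal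

variable {V : Type*} [NormedAddCommGroup V] [NormedSpace ℂ V]
  {X : Type*} [TopologicalSpace X] [ChartedSpace V X] [IsManifold 𝓘(ℂ, V) ω X]
  {n : ℕ} {E : X → Type*} [TopologicalSpace (TotalSpace (Fin n → ℂ) E)]
  [∀ x, AddCommGroup (E x)] [∀ x, Module ℂ (E x)] [∀ x, TopologicalSpace (E x)]
  [∀ x, IsTopologicalAddGroup (E x)] [∀ x, ContinuousSMul ℂ (E x)]
  [FiberBundle (Fin n → ℂ) E] [VectorBundle ℂ (Fin n → ℂ) E]
  [ContMDiffVectorBundle ω (Fin n → ℂ) E 𝓘(ℂ, V)]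
  {D : ReducedDivisor V X} (c : ConnectionForms D (Fin n → ℂ) E)
  {U : Opens X} {v w : Π x : X, TangentSpace 𝓘(ℂ, V) x}

/-- The value at `x` of the connection form on a logarithmic vector field. -/
def ConnectionForms.value (v : Π x : X, TangentSpace 𝓘(ℂ, V) x) (x₀ x : X) : EndC n :=
  extend D (fun y => c.form x₀ y (v y)) x

theorem ConnectionForms.contMDiffAt_value (hv : v ∈ TLog D U) {x₀ x : X} (hx : x ∈ U)
    (hx₀ : x ∈ baseOpen (Fin n → ℂ) E x₀) :
    ContMDiffAt 𝓘(ℂ, V) 𝓘(ℂ, EndC n) ω (c.value v x₀) x :=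
  (c.extendsAt hv hx hx₀).extend_contMDiffAt

theorem ConnectionForms.eventually_value (hv : v ∈ TLog D U) {x₀ x : X} (hx : x ∈ U)
    (hx₀ : x ∈ baseOpen (Fin n → ℂ) E x₀) :
    ∀ᶠ z in 𝓝 x, z ∉ D.supp → c.value v x₀ z = c.form x₀ z (v z) :=
  (c.extendsAt hv hx hx₀).eventually_extend_eq

/-- The rule for the forms holds off D; both sides here are continuous, so it extends over D by
density. -/
theorem ConnectionForms.value_gauge (hv : v ∈ TLog D U) {x₀ x₁ x : X} (hx : x ∈ U)
    (h₀ : x ∈ baseOpen (Fin n → ℂ) E x₀) (h₁ : x ∈ baseOpen (Fin n → ℂ) E x₁) :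
    mvfderiv 𝓘(ℂ, V) (transition (Fin n → ℂ) E x₀ x₁) x (v x) +
        (c.value v x₁ x).comp (transition (Fin n → ℂ) E x₀ x₁ x) =
      (transition (Fin n → ℂ) E x₀ x₁ x).comp (c.value v x₀ x) := by
  have hT : ContMDiffAt 𝓘(ℂ, V) 𝓘(ℂ, EndC n) ω (transition (Fin n → ℂ) E x₀ x₁) x :=
    contMDiffAt_transition h₀ h₁
  have hf := ((contMDiffAt_mvfderiv_apply hT
    (Sec.contMDiffAt (mem_TLog_iff.1 hv).1 hx)).add
      ((c.contMDiffAt_value hv hx h₁).clm_comp hT)).continuousAt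
  have hh := (hT.clm_comp (c.contMDiffAt_value hv hx h₀)).continuousAt
  refine eq_of_eventually_notMem (D := D) hf hh ?_
  filter_upwards [baseOpen_mem_nhds h₀, baseOpen_mem_nhds h₁, c.eventually_value hv hx h₀,
    c.eventually_value hv hx h₁] with z hz₀ hz₁ h2 h3 hzD
  rw [h2 hzD]
  refine (?_ : _ = _).trans (c.gauge x₀ x₁ z hz₀ hz₁ hzD (v z))
  exact congrArg (fun A : EndC n => mvfderiv 𝓘(ℂ, V) (transition (Fin n → ℂ) E x₀ x₁) z (v z) +
    A.comp (transition (Fin n → ℂ) E x₀ x₁ z)) (h3 hzD)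

/-- The horizontal lift of a logarithmic vector field to the frame bundle. -/
def ConnectionForms.lift (v : Π x : X, TangentSpace 𝓘(ℂ, V) x) (q : frames n E) :
    TangentSpace (frameModel V n) q :=
  frameLift (frameProj n E q) q (v (frameProj n E q))
    (-(c.value v (frameProj n E q) (frameProj n E q)).comp (frameCoord (frameProj n E q) q))

theorem ConnectionForms.mfderiv_frameProj_lift (v : Π x : X, TangentSpace 𝓘(ℂ, V) x)
    (q : frames n E) :
    mfderiv (frameModel V n) 𝓘(ℂ, V) (frameProj n E) q (c.lift v q) = v (frameProj n E q) :=
  mfderiv_frameProj_frameLift (mem_baseOpen_self _ _) _ _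

/-- `lift` is defined with the trivialization centred at the base point of q. The gauge rule gives
the same expression −A(v)C in every other trivialization, so one fixed trivialization serves on a
whole neighbourhood. -/
theorem ConnectionForms.mvfderiv_frameCoord_lift (hv : v ∈ TLog D U) {x₀ : X} {q : frames n E}
    (hq : frameProj n E q ∈ U) (h₀ : frameProj n E q ∈ baseOpen (Fin n → ℂ) E x₀) :
    mvfderiv (frameModel V n) (frameCoord (n := n) (E := E) x₀) q (c.lift v q) =
      -(c.value v x₀ (frameProj n E q)).comp (frameCoord x₀ q) := by
  have hs := mem_baseOpen_self (Fin n → ℂ) (E := E) (frameProj n E q)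
  have h := c.value_gauge hv hq hs h₀
  rw [mvfderiv_frameCoord_eq_transition hs h₀, c.mfderiv_frameProj_lift,
    eq_sub_of_add_eq h, ConnectionForms.lift, mvfderiv_frameCoord_frameLift hs,
    frameCoord_eq_transition hs (x₁ := x₀)]
  ext1 w
  simp only [add_apply, ContinuousLinearMap.comp_apply, sub_apply, neg_apply, map_neg]
  abel

/-- The characterization of the lift from which additivity, 𝒪-linearity, restriction and invariance
follow by comparing components. -/
theorem ConnectionForms.eq_lift (hv : v ∈ TLog D U) {x₀ : X} {q : frames n E}
    (hq : frameProj n E q ∈ U) (h₀ : frameProj n E q ∈ baseOpen (Fin n → ℂ) E x₀)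
    {ξ : TangentSpace (frameModel V n) q}
    (hp : mfderiv (frameModel V n) 𝓘(ℂ, V) (frameProj n E) q ξ = v (frameProj n E q))
    (hc : mvfderiv (frameModel V n) (frameCoord (n := n) (E := E) x₀) q ξ =
      -(c.value v x₀ (frameProj n E q)).comp (frameCoord x₀ q)) : ξ = c.lift v q :=
  frameTangent_ext h₀ (hp.trans (c.mfderiv_frameProj_lift v q).symm)
    (hc.trans (c.mvfderiv_frameCoord_lift hv hq h₀).symm)

/-- In a fixed trivialization the lift is the pullback by `frameChart` of the holomorphic field (v,
−A(v)C) on X × End(ℂⁿ). -/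
theorem ConnectionForms.contMDiffAt_lift [FiniteDimensional ℂ V] (hv : v ∈ TLog D U)
    {q : frames n E} (hq : frameProj n E q ∈ U) :
    ContMDiffAt (frameModel V n) ((frameModel V n).prod 𝓘(ℂ, V × EndC n)) ω
      (fun q' : frames n E => TotalSpace.mk' (V × EndC n) q' (c.lift v q')) q := by
  -- Pulling a field back inverts the derivative of the chart; inversion of operators is analytic on
  -- complete spaces.
  have := FiniteDimensional.complete ℂ V
  set x₀ := frameProj n E q with hx₀
  have h₀ := mem_baseOpen_self (Fin n → ℂ) (E := E) x₀
  have hN : ContMDiffAt (frameModel V n) 𝓘(ℂ, EndC n) ω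
      (fun z : X × EndC n => -(c.value v x₀ z.1).comp z.2) (frameChart x₀ q) := by
    have h1 : ContMDiffAt (frameModel V n) 𝓘(ℂ, EndC n) ω
        (fun z : X × EndC n => c.value v x₀ z.1) (frameChart x₀ q) :=
      ContMDiffAt.comp (I' := 𝓘(ℂ, V)) (frameChart x₀ q) (c.contMDiffAt_value hv hq h₀)
        contMDiffAt_fst
    exact (h1.clm_comp contMDiffAt_snd).neg
  have hW := contMDiffAt_prodField (z := frameChart x₀ q)
    (Sec.contMDiffAt (mem_TLog_iff.1 hv).1 hq) hN
  have h := hW.mpullback_vectorField_preimage (n := ω) (contMDiffAt_frameChart h₀)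
    (isInvertible_mfderiv_frameChart h₀) (by simp)
  refine h.congr_of_eventuallyEq ?_
  filter_upwards [eventually_frameProj_mem h₀,
    (frameProj n E).continuous.continuousAt.eventually (U.2.mem_nhds hq)] with q' h1 h2
  refine congrArg (TotalSpace.mk' (V × EndC n) q') (c.eq_lift hv h2 h1 ?_ ?_).symm
  · exact mfderiv_frameProj_frameLift h1 _ _
  · exact mvfderiv_frameCoord_frameLift h1 _ _

theorem ConnectionForms.value_add (hv : v ∈ TLog D U) (hw : w ∈ TLog D U) {x₀ x : X} (hx : x ∈ U)
    (hx₀ : x ∈ baseOpen (Fin n → ℂ) E x₀) :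
    c.value (v + w) x₀ x = c.value v x₀ x + c.value w x₀ x := by
  refine extend_eq_of_continuousAt (h := fun z => c.value v x₀ z + c.value w x₀ z)
    ((c.contMDiffAt_value hv hx hx₀).add (c.contMDiffAt_value hw hx hx₀)).continuousAt ?_
  filter_upwards [c.eventually_value hv hx hx₀, c.eventually_value hw hx hx₀] with z h1 h2 hzD
  rw [h1 hzD, h2 hzD, Pi.add_apply, map_add]

theorem ConnectionForms.value_smul (hv : v ∈ TLog D U) {f : X → ℂ} {x₀ x : X} (hx : x ∈ U)
    (hf : ContMDiffAt 𝓘(ℂ, V) 𝓘(ℂ) ω f x) (hx₀ : x ∈ baseOpen (Fin n → ℂ) E x₀) :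
    c.value (fun y => f y • v y) x₀ x = f x • c.value v x₀ x := by
  refine extend_eq_of_continuousAt (h := fun z => f z • c.value v x₀ z)
    (hf.smul (c.contMDiffAt_value hv hx hx₀)).continuousAt ?_
  filter_upwards [c.eventually_value hv hx hx₀] with z h1 hzD
  rw [h1 hzD, map_smul]

theorem ConnectionForms.lift_add (hv : v ∈ TLog D U) (hw : w ∈ TLog D U) {q : frames n E}
    (hq : frameProj n E q ∈ U) : c.lift (v + w) q = c.lift v q + c.lift w q := by
  have h₀ := mem_baseOpen_self (Fin n → ℂ) (E := E) (frameProj n E q)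
  refine (c.eq_lift (add_mem hv hw) hq h₀ ?_ ?_).symm
  · rw [ContinuousLinearMap.map_add, c.mfderiv_frameProj_lift, c.mfderiv_frameProj_lift, Pi.add_apply]
  · rw [ContinuousLinearMap.map_add, c.mvfderiv_frameCoord_lift hv hq h₀, c.mvfderiv_frameCoord_lift hw hq h₀,
      c.value_add hv hw hq h₀, ContinuousLinearMap.add_comp, neg_add]

theorem ConnectionForms.lift_smul (hv : v ∈ TLog D U) {f : X → ℂ}
    (hf : ContMDiffOn 𝓘(ℂ, V) 𝓘(ℂ) ω f U) {q : frames n E} (hq : frameProj n E q ∈ U) :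
    c.lift (fun y => f y • v y) q = f (frameProj n E q) • c.lift v q := by
  have h₀ := mem_baseOpen_self (Fin n → ℂ) (E := E) (frameProj n E q)
  refine (c.eq_lift (TLog.smul_mem hf hv) hq h₀ ?_ ?_).symm
  · rw [ContinuousLinearMap.map_smul, c.mfderiv_frameProj_lift]
  · rw [ContinuousLinearMap.map_smul, c.mvfderiv_frameCoord_lift hv hq h₀,
      c.value_smul hv hq (hf.contMDiffAt (U.2.mem_nhds hq)) h₀, ContinuousLinearMap.smul_comp,
      smul_neg]

theorem ConnectionForms.lift_restrictTo (hv : v ∈ TLog D U) {W : Opens X} (hWU : W ≤ U)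
    {q : frames n E} (hq : frameProj n E q ∈ W) : c.lift (restrictTo W v) q = c.lift v q := by
  have h₀ := mem_baseOpen_self (Fin n → ℂ) (E := E) (frameProj n E q)
  refine (c.eq_lift (TLog.restrict_mem hWU hv) hq h₀ ?_ ?_).symm
  · rw [c.mfderiv_frameProj_lift, restrictTo_of_mem _ hq]
  · rw [c.mvfderiv_frameCoord_lift hv (hWU hq) h₀]
    have h : c.value v (frameProj n E q) (frameProj n E q) =
        c.value (restrictTo W v) (frameProj n E q) (frameProj n E q) := by
      refine extend_congr (c.extendsAt hv (hWU hq) h₀) ?_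
      filter_upwards [W.2.mem_nhds hq] with z hz _
      rw [restrictTo_of_mem _ hz]
    rw [h]

/-- The group multiplies C on the right and A(v) acts on the left, so (−A(v)C)g = −A(v)(Cg). -/
theorem ConnectionForms.mfderiv_smul_lift (hv : v ∈ TLog D U) (g : GL (Fin n) ℂ) {q : frames n E}
    (hq : frameProj n E q ∈ U) :
    mfderiv (frameModel V n) (frameModel V n) (fun q' : frames n E => MulOpposite.op g • q') q
      (c.lift v q) = c.lift v (MulOpposite.op g • q) := by
  have h₀ := mem_baseOpen_self (Fin n → ℂ) (E := E) (frameProj n E q)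
  refine c.eq_lift (q := MulOpposite.op g • q) hv hq h₀ ?_ ?_
  · rw [mfderiv_frameProj_smul, c.mfderiv_frameProj_lift]
    rfl
  · rw [mvfderiv_frameCoord_smul g h₀, c.mvfderiv_frameCoord_lift hv hq h₀]
    rfl

theorem ConnectionForms.lift_mem_logAt [FiniteDimensional ℂ V] (hv : v ∈ TLog D U) :
    restrictTo (U.comap (frameProj n E)) (c.lift v) ∈
      LogAt (frameModel V n) (frameProj n E) (GL (Fin n) ℂ) D U := by
  refine ⟨⟨restrictTo_mem_sec fun q hq => c.contMDiffAt_lift hv hq, fun g q hq => ?_⟩,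
    v, hv, fun q hq => ?_⟩
  · rw [restrictTo_of_mem _ hq, restrictTo_of_mem (x := MulOpposite.op g • q) _ hq]
    exact c.mfderiv_smul_lift hv g hq
  · rw [restrictTo_of_mem _ hq, c.mfderiv_frameProj_lift]

/-- The splitting of the logarithmic Atiyah sequence by horizontal lifts. -/
def ConnectionForms.toSplitting [FiniteDimensional ℂ V] :
    LogAtiyahSplitting (frameModel V n) (frameProj n E) (GL (Fin n) ℂ)
      (frameProj_surjective n E) D where
  eta U :=
    { toFun := fun v => ⟨restrictTo (U.comap (frameProj n E)) (c.lift v.1), c.lift_mem_logAt v.2⟩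
      map_add' := fun v w => by
        refine Subtype.ext (funext fun q => ?_)
        by_cases hq : q ∈ U.comap (frameProj n E)
        · simp only [Submodule.coe_add, Pi.add_apply, restrictTo_of_mem _ hq]
          exact c.lift_add v.2 w.2 hq
        · simp only [Submodule.coe_add, Pi.add_apply, restrictTo_of_notMem _ hq, add_zero]
      map_smul' := fun a v => by
        refine Subtype.ext (funext fun q => ?_)
        by_cases hq : q ∈ U.comap (frameProj n E)
        · simp only [Submodule.coe_smul, Pi.smul_apply, restrictTo_of_mem _ hq, RingHom.id_apply]
          exact c.lift_smul v.2 (f := fun _ => a) contMDiffOn_const hq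
        · simp only [Submodule.coe_smul, Pi.smul_apply, restrictTo_of_notMem _ hq, smul_zero] }
  smul U f hf v q := by
    by_cases hq : q ∈ U.comap (frameProj n E)
    · simp only [LinearMap.coe_mk, AddHom.coe_mk, restrictTo_of_mem _ hq]
      exact c.lift_smul v.2 hf hq
    · simp only [LinearMap.coe_mk, AddHom.coe_mk, restrictTo_of_notMem _ hq, smul_zero]
  restrict U W hWU v := by
    funext q
    by_cases hq : q ∈ W.comap (frameProj n E)
    · have hqU : q ∈ U.comap (frameProj n E) := hWU hq
      simp only [LinearMap.coe_mk, AddHom.coe_mk, restrictTo_of_mem _ hq, restrictTo_of_mem _ hqU]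
      exact c.lift_restrictTo v.2 hWU hq
    · simp only [LinearMap.coe_mk, AddHom.coe_mk, restrictTo_of_notMem _ hq]
  section_eq U := by
    refine LinearMap.ext fun v => Subtype.ext ?_
    refine ProjectsTo.unique (frameProj_surjective n E) (Subtype.property _) v.2
      (logProj_spec (frameModel V n) (frameProj n E) (GL (Fin n) ℂ)
        (frameProj_surjective n E) D U _) fun q hq => ?_
    simp only [LinearMap.coe_mk, AddHom.coe_mk, restrictTo_of_mem _ hq]
    exact c.mfderiv_frameProj_lift v.1 q

end Horizontal

end LogAtiyah

end

noncomputable section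

namespace LogAtiyah

/-! ### From splittings to connection forms -/

section Splitting

/-- GL acts transitively on the frames over a point; this supplies the group element. -/
theorem exists_glMap_eq {n : ℕ} {A : EndC n} (hA : Function.Bijective A) :
    ∃ g : GL (Fin n) ℂ, glMap g = A := by
  let e : (Fin n → ℂ) ≃ₗ[ℂ] (Fin n → ℂ) := LinearEquiv.ofBijective A.toLinearMap hA
  refine ⟨⟨LinearMap.toMatrix' e.toLinearMap, LinearMap.toMatrix' e.symm.toLinearMap, ?_, ?_⟩, ?_⟩
  · rw [← LinearMap.toMatrix'_comp, LinearEquiv.comp_symm, LinearMap.toMatrix'_id]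
  · rw [← LinearMap.toMatrix'_comp, LinearEquiv.symm_comp, LinearMap.toMatrix'_id]
  · ext1 w
    rw [glMap_apply]
    exact LinearMap.toMatrix'_mulVec e.toLinearMap w

variable {V : Type*} [NormedAddCommGroup V] [NormedSpace ℂ V]
  {X : Type*} [TopologicalSpace X] [ChartedSpace V X] [IsManifold 𝓘(ℂ, V) ω X]
  {n : ℕ} {E : X → Type*} [TopologicalSpace (TotalSpace (Fin n → ℂ) E)]
  [∀ x, AddCommGroup (E x)] [∀ x, Module ℂ (E x)] [∀ x, TopologicalSpace (E x)]
  [∀ x, IsTopologicalAddGroup (E x)] [∀ x, ContinuousSMul ℂ (E x)]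
  [FiberBundle (Fin n → ℂ) E] [VectorBundle ℂ (Fin n → ℂ) E]
  [ContMDiffVectorBundle ω (Fin n → ℂ) E 𝓘(ℂ, V)]
  {D : ReducedDivisor V X}

variable (D) in
/-- The fields with constant coordinates in the chart at `y`, on the complement of `D`. -/
def constFields (y : X) : V →ₗ[ℂ] TLog D (D.away (chartOpen V y)) where
  toFun w := ⟨_, constField_mem_TLog (W := D.away (chartOpen V y)) D.away_le (fun _ h => h.2) w⟩
  map_add' w w' := by
    refine Subtype.ext (funext fun z => ?_)
    by_cases hz : z ∈ D.away (chartOpen V y)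
    · simp only [Submodule.coe_add, Pi.add_apply, restrictTo_of_mem _ hz, map_add]
    · simp only [Submodule.coe_add, Pi.add_apply, restrictTo_of_notMem _ hz, add_zero]
  map_smul' a w := by
    refine Subtype.ext (funext fun z => ?_)
    by_cases hz : z ∈ D.away (chartOpen V y)
    · simp only [Submodule.coe_smul, Pi.smul_apply, restrictTo_of_mem _ hz, map_smul,
        RingHom.id_apply]
    · simp only [Submodule.coe_smul, Pi.smul_apply, restrictTo_of_notMem _ hz, smul_zero]

theorem constFields_apply {y z : X} (hz : z ∈ D.away (chartOpen V y)) (w : V) :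
    (constFields D y w).1 z = ofTan V y z w :=
  restrictTo_of_mem (fun z => ofTan V y z w) hz

variable (η : LogAtiyahSplitting (frameModel V n) (frameProj n E) (GL (Fin n) ℂ)
  (frameProj_surjective n E) D)

theorem LogAtiyahSplitting.mfderiv_frameProj_eta {U : Opens X} (v : TLog D U) {q : frames n E}
    (hq : frameProj n E q ∈ U) :
    mfderiv (frameModel V n) 𝓘(ℂ, V) (frameProj n E) q ((η.eta U v).1 q) =
      v.1 (frameProj n E q) := by
  have h := logProj_spec (frameModel V n) (frameProj n E) (GL (Fin n) ℂ)
    (frameProj_surjective n E) D U (η.eta U v) q hq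
  rw [h]
  have h' := LinearMap.congr_fun (η.section_eq U) v
  exact congrFun (congrArg Subtype.val h') _

theorem LogAtiyahSplitting.eta_restrictTo {U W : Opens X} (hWU : W ≤ U) (v : TLog D U)
    {q : frames n E} (hq : frameProj n E q ∈ W) :
    (η.eta W ⟨restrictTo W v.1, TLog.restrict_mem hWU v.2⟩).1 q = (η.eta U v).1 q := by
  rw [η.restrict U W hWU v]
  exact restrictTo_of_mem (U := W.comap (frameProj n E)) _ hq

/-- The horizontal lift to a frame `q` at `y` of a tangent vector at a point `y` outside `D`. -/
def LogAtiyahSplitting.hor (y : X) (q : frames n E) :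
    TangentSpace 𝓘(ℂ, V) y →ₗ[ℂ] TangentSpace (frameModel V n) q where
  toFun v := (η.eta _ (constFields D y (toTan V y y v))).1 q
  map_add' v w := by
    rw [map_add, map_add, map_add]
    rfl
  map_smul' a v := by
    rw [ContinuousLinearMap.map_smul, LinearMap.map_smul, LinearMap.map_smul]
    rfl

theorem mem_away_chartOpen {y : X} (hy : y ∉ D.supp) : y ∈ D.away (chartOpen V y) :=
  ⟨mem_baseOpen_self V (E := (TangentSpace 𝓘(ℂ, V) : X → Type _)) y, hy⟩

theorem LogAtiyahSplitting.mfderiv_frameProj_hor {q : frames n E} (hq : frameProj n E q ∉ D.supp)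
    (v : TangentSpace 𝓘(ℂ, V) (frameProj n E q)) :
    mfderiv (frameModel V n) 𝓘(ℂ, V) (frameProj n E) q (η.hor (frameProj n E q) q v) = v := by
  have h := mem_away_chartOpen hq
  refine (η.mfderiv_frameProj_eta _ h).trans ?_
  rw [constFields_apply h, ofTriv_toTriv h.1]

/-- Off D the coordinate fields are logarithmic and locally v = ∑ fᵢ∂ᵢ. By restriction and
𝒪-linearity, η(v) at q is ∑ fᵢ(y)η(∂ᵢ), which depends only on v(y). Keeping y separate from the
projection of q avoids transporting tangent vectors along their equality. -/
theorem LogAtiyahSplitting.eta_eq_hor [FiniteDimensional ℂ V] {U : Opens X} (v : TLog D U)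
    {y : X} {q : frames n E} (hqy : frameProj n E q = y) (hyU : y ∈ U) (hyD : y ∉ D.supp) :
    (η.eta U v).1 q = η.hor y q (v.1 y) := by
  set W : Opens X := U ⊓ D.away (chartOpen V y) with hW
  have hyW : y ∈ W := ⟨hyU, mem_away_chartOpen hyD⟩
  let b := Module.finBasis ℂ V
  let f : Fin (Module.finrank ℂ V) → X → ℂ := fun i z => b.repr (toTan V y z (v.1 z)) i
  let k : Fin (Module.finrank ℂ V) → TLog D W := fun i =>
    ⟨_, TLog.restrict_mem inf_le_right (constFields D y (b i)).2⟩
  have hf : ∀ i, ContMDiffOn 𝓘(ℂ, V) 𝓘(ℂ) ω (f i) W := fun i z hz =>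
    ((LinearMap.toContinuousLinearMap (b.coord i)).contMDiff.contMDiffAt.comp z
      (Sec.contMDiffAt_toTriv (mem_TLog_iff.1 v.2).1 hz.1 hz.2.1)).contMDiffWithinAt
  have hv : (⟨_, TLog.restrict_mem (W := W) inf_le_left v.2⟩ : TLog D W) =
      ∑ i, ⟨fun z => f i z • (k i).1 z, TLog.smul_mem (hf i) (k i).2⟩ := by
    refine Subtype.ext (funext fun z => ?_)
    rw [AddSubmonoidClass.coe_finsetSum, Finset.sum_apply]
    change restrictTo W v.1 z = ∑ i, f i z • (k i).1 z
    by_cases hz : z ∈ W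
    · have h : ∀ i, (k i).1 z = ofTan V y z (b i) := fun i =>
        (restrictTo_of_mem _ hz).trans (constFields_apply hz.2 _)
      rw [restrictTo_of_mem _ hz]
      simp only [h]
      conv_lhs => rw [← ofTriv_toTriv (F := V) hz.2.1 (v.1 z), ← b.sum_repr (toTan V y z (v.1 z)),
        map_sum]
      exact Finset.sum_congr rfl fun i _ => map_smul _ _ _
    · have h : ∀ i, (k i).1 z = 0 := fun i => restrictTo_of_notMem _ hz
      simp only [h, restrictTo_of_notMem _ hz, smul_zero, Finset.sum_const_zero]
  have hqW : frameProj n E q ∈ W := by rwa [hqy]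
  rw [← η.eta_restrictTo (W := W) inf_le_left v hqW, hv, map_sum,
    AddSubmonoidClass.coe_finsetSum, Finset.sum_apply]
  have h : ∀ i, (η.eta W (k i)).1 q = (η.eta _ (constFields D y (b i))).1 q := fun i =>
    η.eta_restrictTo inf_le_right _ hqW
  simp only [η.smul W _ (hf _) (k _), h, hqy]
  refine (?_ : _ = (η.eta _ (constFields D y (toTan V y y (v.1 y)))).1 q)
  conv_rhs => rw [← b.sum_repr (toTan V y y (v.1 y)), map_sum, map_sum,
    AddSubmonoidClass.coe_finsetSum, Finset.sum_apply]
  refine Finset.sum_congr rfl fun i _ => ?_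
  rw [LinearMap.map_smul, LinearMap.map_smul]
  rfl

theorem LogAtiyahSplitting.mfderiv_smul_hor (g : GL (Fin n) ℂ) {y : X} {q : frames n E}
    (hqy : frameProj n E q = y) (hyD : y ∉ D.supp) (v : TangentSpace 𝓘(ℂ, V) y) :
    mfderiv (frameModel V n) (frameModel V n) (fun q' : frames n E => MulOpposite.op g • q') q
      (η.hor y q v) = η.hor y (MulOpposite.op g • q) v :=
  (η.eta _ (constFields D y (toTan V y y v))).2.1.2 g q (by
    subst hqy
    exact mem_away_chartOpen hyD)

variable [FiniteDimensional ℂ V]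

/-- The connection form of a splitting in the trivialization at `x₀`. -/
def LogAtiyahSplitting.form (x₀ y : X) : TangentSpace 𝓘(ℂ, V) y →L[ℂ] EndC n :=
  -- At the frame with C = 1 the matrix component −A(v)C of the horizontal lift is −A(v), hence the
  -- sign.
  let L : V →ₗ[ℂ] EndC n := -(mvfderiv (frameModel V n) (frameCoord (n := n) (E := E) x₀)
    (mkFrame x₀ (y, ContinuousLinearMap.id ℂ _))).toLinearMap.comp
      (η.hor y (mkFrame x₀ (y, ContinuousLinearMap.id ℂ _)))
  (show V →L[ℂ] EndC n from LinearMap.toContinuousLinearMap L)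

theorem LogAtiyahSplitting.form_apply (x₀ y : X) (v : TangentSpace 𝓘(ℂ, V) y) :
    η.form x₀ y v = -mvfderiv (frameModel V n) (frameCoord (n := n) (E := E) x₀)
      (mkFrame x₀ (y, ContinuousLinearMap.id ℂ _))
      (η.hor y (mkFrame x₀ (y, ContinuousLinearMap.id ℂ _)) v) := rfl

/-- Every frame over y is σ·g, where σ has matrix 1 and g is the matrix of the frame. Invariance of
η multiplies the component −A(v) at σ by g on the right. -/
theorem LogAtiyahSplitting.mvfderiv_frameCoord_hor {x₀ y : X} {q : frames n E}
    (hqy : frameProj n E q = y) (hy : y ∈ baseOpen (Fin n → ℂ) E x₀) (hyD : y ∉ D.supp)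
    (v : TangentSpace 𝓘(ℂ, V) y) :
    mvfderiv (frameModel V n) (frameCoord (n := n) (E := E) x₀) q (η.hor y q v) =
      -(η.form x₀ y v).comp (frameCoord x₀ q) := by
  have hq : frameProj n E q ∈ baseOpen (Fin n → ℂ) E x₀ := by rwa [hqy]
  obtain ⟨g, hg⟩ := exists_glMap_eq (frameCoord_bijective hq)
  rw [η.form_apply]
  set σ : frames n E := mkFrame x₀ (y, ContinuousLinearMap.id ℂ _) with hσ
  have hσy : frameProj n E σ = y := frameProj_mkFrame _ _
  have hσc : frameCoord x₀ σ = ContinuousLinearMap.id ℂ _ :=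
    frameCoord_mkFrame (z := (y, ContinuousLinearMap.id ℂ _)) hy Function.bijective_id
  obtain rfl : MulOpposite.op g • σ = q := by
    refine frame_ext (x₀ := x₀) ?_ ?_ ?_
    · rw [frameProj_smul, hσy]; exact hy
    · rw [frameProj_smul, hσy, hqy]
    · rw [frameCoord_smul, hσc, ← hg]; rfl
  rw [← η.mfderiv_smul_hor g hσy hyD, mvfderiv_frameCoord_smul g (by rwa [hσy]), ← hg,
    ContinuousLinearMap.neg_comp, neg_neg]

/-- The connection forms of a splitting of the logarithmic Atiyah sequence. -/
def LogAtiyahSplitting.toConnectionForms : ConnectionForms D (Fin n → ℂ) E where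
  form := η.form
  extendsAt_form x₀ U hU v hv x hx := by
    have hσ : ContMDiffAt 𝓘(ℂ, V) (frameModel V n) ω
        (fun y => mkFrame (E := E) x₀ (y, ContinuousLinearMap.id ℂ (Fin n → ℂ))) x :=
      ContMDiffAt.comp (I' := frameModel V n) x
        (contMDiffAt_mkFrame (z := (x, ContinuousLinearMap.id ℂ _)) (hU hx) Function.bijective_id)
        (contMDiffAt_id.prodMk contMDiffAt_const)
    have h := contMDiffAt_mvfderiv_apply (J := frameModel V n)
      (x := mkFrame (E := E) x₀ (x, ContinuousLinearMap.id ℂ (Fin n → ℂ)))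
      (contMDiffAt_frameCoord (x₀ := x₀) (by rw [frameProj_mkFrame]; exact hU hx))
      (Sec.contMDiffAt (η.eta U ⟨v, hv⟩).2.1.1
        (show frameProj n E _ ∈ U by rw [frameProj_mkFrame]; exact hx))
    -- The extension across D is minus the matrix component of η(v) along the local section σ, which
    -- is holomorphic because η(v) is a holomorphic field on all of p⁻¹(U).
    refine ⟨_, (h.comp x hσ).neg, ?_⟩
    filter_upwards [U.2.mem_nhds hx] with z hz hzD
    rw [η.form_apply]
    refine congrArg (fun ξ => -mvfderiv (frameModel V n) (frameCoord (n := n) (E := E) x₀) _ ξ) ?_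
    exact η.eta_eq_hor ⟨v, hv⟩ (frameProj_mkFrame _ _) hz hzD
  gauge x₀ x₁ y h₀ h₁ hyD v := by
    obtain ⟨q, rfl, hc⟩ : ∃ q : frames n E, frameProj n E q = y ∧
        frameCoord x₀ q = ContinuousLinearMap.id ℂ _ :=
      ⟨mkFrame x₀ (y, ContinuousLinearMap.id ℂ _), frameProj_mkFrame _ _,
        frameCoord_mkFrame (z := (y, ContinuousLinearMap.id ℂ _)) h₀ Function.bijective_id⟩
    -- Evaluated on a horizontal vector at the frame with C₀ = 1 and C₁ = T, this reads −A₁T = dT −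
    -- TA₀.
    have h := mvfderiv_frameCoord_eq_transition h₀ h₁ (η.hor _ q v)
    rw [η.mfderiv_frameProj_hor hyD, η.mvfderiv_frameCoord_hor rfl h₀ hyD,
      η.mvfderiv_frameCoord_hor rfl h₁ hyD, frameCoord_eq_transition h₀, hc,
      ContinuousLinearMap.comp_id, ContinuousLinearMap.comp_id, ContinuousLinearMap.comp_id,
      ContinuousLinearMap.comp_neg, ← sub_eq_add_neg, eq_sub_iff_add_eq] at h
    rw [← h]
    abel

end Splitting

end LogAtiyah

end

/-! ### The equivalence, through connection forms -/

theorem proposition3p1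
    {V : Type*} [NormedAddCommGroup V] [NormedSpace ℂ V] [FiniteDimensional ℂ V]
    {X : Type*} [TopologicalSpace X] [T2Space X] [ConnectedSpace X]
    [ChartedSpace V X] [IsManifold 𝓘(ℂ, V) ω X]
    (n : ℕ) (E : X → Type*) [TopologicalSpace (TotalSpace (Fin n → ℂ) E)]
    [∀ x, AddCommGroup (E x)] [∀ x, Module ℂ (E x)] [∀ x, TopologicalSpace (E x)]
    [∀ x, IsTopologicalAddGroup (E x)] [∀ x, ContinuousSMul ℂ (E x)]
    [FiberBundle (Fin n → ℂ) E] [VectorBundle ℂ (Fin n → ℂ) E]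
    [ContMDiffVectorBundle ω (Fin n → ℂ) E 𝓘(ℂ, V)]
    (D : LogAtiyah.ReducedDivisor V X) :
    Nonempty (LogAtiyah.LogConnection (Fin n → ℂ) E D) ↔
      Nonempty (LogAtiyah.LogAtiyahSplitting
        (𝓘(ℂ, V).prod 𝓘(ℂ, (Fin n → ℂ) →L[ℂ] (Fin n → ℂ)))
        (LogAtiyah.frameProj n E) (GL (Fin n) ℂ) (LogAtiyah.frameProj_surjective n E) D) :=
  ⟨fun ⟨c⟩ => ⟨c.toConnectionForms.toSplitting⟩, fun ⟨η⟩ => ⟨η.toConnectionForms.toLogConnection⟩⟩
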